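/- **Setting.** Let $T>0$, let $(\Omega,\mathcal F,(\mathcal F_t)_{t\in[0,T]},\mathbb Q)$ be a filtered probability space carrying a one-dimensional Wiener process $(W_t)_{t\in[0,T]}$, let $r,\mu\in\mathbb R$, $\sigma>0$, $\gamma=\sigma^{-1}(\mu-r)$, and let $\tilde Z_T=\exp\bigl(-(r+\tfrac12\gamma^2)T-\gamma W_T\bigr)$ be the state price density at time $T$ of the Black–Scholes market. Let $v_0>0$ be the initial capital of the fund. A fee structure is a triple $(m,\alpha,c)\in[0,1]\times(0,1]\times[0,1]$. If the fund ends at $v\ge 0$, the investor receives $$I(v)=\begin{cases} v+v_0(c-m), & v-mv_0<(1-c)v_0,\\ v_0, & (1-c)v_0\le v-mv_0<v_0,\\ v-mv_0-\alpha\,(v-(1+m)v_0), & v-mv_0\ge v_0,\end{cases}$$ and the manager receives $M(v)=v-I(v)$. Let $\mathcal P\subseteq[0,1]\times(0,1]\times[0,1]$ be a nonempty compact set of admissible fee structures. For $X\in\{M,I\}$ let $\tilde U_X:D_X\to\mathbb R$ be a utility function on an interval $D_X\subseteq\mathbb R$ unbounded above: $\tilde U_X$ is continuous, strictly increasing and strictly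 concave on $D_X$, continuously differentiable in the interior of $D_X$, and $\lim_{v\to+\infty}\tilde U_X'(v)=0$. Assume $(m-c)v_0\in D_M$ and $(c-m)v_0\in D_I$ for all $(m,\alpha,c)\in\mathcal P$. Put $U_M(v)=\tilde U_M(M(v))$ and $U_I(v)=\tilde U_I(I(v))$ for $v\ge0$, and let $u_M$ be the concave envelope (smallest concave majorant) of $U_M$ on $[0,\infty)$. Assume that for every $(m,\alpha,c)\in\mathcal P$ the following integrability condition holds: if $v^*(y,z)$ denotes a maximiser of $u_M(v)-yzv$ over $v\ge0$ (for $y,z>0$), then $\mathbb E[\tilde Z_T\,v^*(y,\tilde Z_T)]<\infty$ for every $y>0$. For a fee structure $(m,\alpha,c)\in\mathcal P$ let $V_T^*=V_T^*(m,\alpha,c)$ be an optimal terminal value of the fund for the manager, i.e. a solution of $$\max_{V_T}\ \mathbb E[U_M(V_T)]\quad\text{s.t.}\quad \mathbb E[\tilde Z_TV_T]\le v_0,\quad V_T\ge0 \ \text{ a.s.},\quad V_T\ \mathcal F_T\text{-measurable},$$ and put $\phi_M(m,\alpha,c)=\mathbb E[U_M(V_T^*)]$ and $\phi_I(m,\alpha,c)=\mathbb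 E[U_I(V_T^*)]$. **Proposition.** For every $(m,\alpha,c)\in\mathcal P$ an optimal $V_T^*$ exists, and $\phi_M(m,\alpha,c)$ and $\phi_I(m,\alpha,c)$ are finite and do not depend on the choice of $V_T^*$. The function $\phi_M$ attains its minimum and its maximum on $\mathcal P$, and for every $$\phi_{\min}\in\Bigl[\min_{(m,\alpha,c)\in\mathcal P}\phi_M(m,\alpha,c),\ \max_{(m,\alpha,c)\in\mathcal P}\phi_M(m,\alpha,c)\Bigr]$$ there exists $(m^*,\alpha^*,c^*)$ that solves $$\max_{m,\alpha,c}\ \phi_I(m,\alpha,c)\quad\text{s.t.}\quad \phi_M(m,\alpha,c)\ge\phi_{\min},\quad (m,\alpha,c)\in\mathcal P .$$ -/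

import Mathlib

open MeasureTheory ProbabilityTheory Filter Topology Set
open scoped NNReal ENNReal

noncomputable section

namespace FirstLoss

/-- A one-dimensional Wiener process on `[0, T]` relative to the filtration `ℱ`; only the times
`t ≤ T` are constrained. -/
structure IsWienerProcess {Ω : Type*} {mΩ : MeasurableSpace Ω} (Q : Measure Ω)
    (ℱ : Filtration ℝ≥0 mΩ) (T : ℝ≥0) (W : ℝ≥0 → Ω → ℝ) : Prop where
  adapted : ∀ t ≤ T, Measurable[ℱ t] (W t)
  zero : ∀ᵐ ω ∂Q, W 0 ω = 0
  indep_increments : ∀ s t, s ≤ t → t ≤ T →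
    Indep (MeasurableSpace.comap (fun ω => W t ω - W s ω) inferInstance) (ℱ s) Q
  gaussian_increments : ∀ s t, s ≤ t → t ≤ T →
    Q.map (fun ω => W t ω - W s ω) = gaussianReal 0 (t - s)
  continuous_paths : ∀ᵐ ω ∂Q, ContinuousOn (fun t => W t ω) (Iic T)

/-- The market price of risk of the Black-Scholes market with interest rate `r`, drift `μ` and
volatility `σ`. -/
def marketPriceOfRisk (r μ σ : ℝ) : ℝ := σ⁻¹ * (μ - r)

/-- The state price density `Z̃_t` of the Black-Scholes market driven by `W`. -/
def statePriceDensity {Ω : Type*} (r μ σ : ℝ) (W : ℝ≥0 → Ω → ℝ) (t : ℝ≥0) (ω : Ω) : ℝ :=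
  Real.exp (-(r + (1 / 2) * marketPriceOfRisk r μ σ ^ 2) * (t : ℝ)
    - marketPriceOfRisk r μ σ * W t ω)

/-- A fee structure `(m, α, c)`: management fee, performance fee, first-loss coverage. -/
abbrev Fee : Type := ℝ × ℝ × ℝ

/-- The terminal wealth of the investor when the fund ends at `v`. -/
def investorPayoff (v₀ : ℝ) (p : Fee) (v : ℝ) : ℝ :=
  if v - p.1 * v₀ < (1 - p.2.2) * v₀ then v + v₀ * (p.2.2 - p.1)
  else if v - p.1 * v₀ < v₀ then v₀
  else v - p.1 * v₀ - p.2.1 * (v - (1 + p.1) * v₀)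

/-- The terminal wealth of the manager when the fund ends at `v`. -/
def managerPayoff (v₀ : ℝ) (p : Fee) (v : ℝ) : ℝ := v - investorPayoff v₀ p v

/-- A utility function with domain `D`, an interval that is unbounded above; values of `U`
outside `D` are irrelevant (they stand for `-∞`). -/
structure IsUtility (D : Set ℝ) (U : ℝ → ℝ) : Prop where
  isUpperSet : IsUpperSet D
  strictMonoOn : StrictMonoOn U D
  strictConcaveOn : StrictConcaveOn ℝ D U
  continuousOn : ContinuousOn U D
  contDiffOn : ContDiffOn ℝ 1 U (interior D)
  inada_top : Tendsto (deriv U) atTop (𝓝 0)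

/-- The manager's utility `U_M` as a function of the fund's terminal value. -/
def managerUtility (UM : ℝ → ℝ) (v₀ : ℝ) (p : Fee) (v : ℝ) : ℝ := UM (managerPayoff v₀ p v)

/-- The investor's utility `U_I` as a function of the fund's terminal value. -/
def investorUtility (UI : ℝ → ℝ) (v₀ : ℝ) (p : Fee) (v : ℝ) : ℝ := UI (investorPayoff v₀ p v)

/-- The expectation of `X` as an extended real number: `E[X⁺] - E[X⁻]`. -/
def extExpectation {Ω : Type*} [MeasurableSpace Ω] (Q : Measure Ω) (X : Ω → ℝ) : EReal :=
  ((∫⁻ ω, ENNReal.ofReal (X ω) ∂Q : ℝ≥0∞) : EReal)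
    - ((∫⁻ ω, ENNReal.ofReal (-X ω) ∂Q : ℝ≥0∞) : EReal)

/-- The constraints on terminal values: `V` is a nonnegative `𝒢`-measurable random variable with
`E[Z V] ≤ v₀`. -/
structure IsFeasible {Ω : Type*} (𝒢 : MeasurableSpace Ω)
    {mΩ : MeasurableSpace Ω} (Q : Measure Ω) (Z : Ω → ℝ) (v₀ : ℝ) (V : Ω → ℝ) : Prop where
  measurable : Measurable[𝒢] V
  nonneg : ∀ᵐ ω ∂Q, 0 ≤ V ω
  budget : ∫⁻ ω, ENNReal.ofReal (Z ω * V ω) ∂Q ≤ ENNReal.ofReal v₀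

/-- `V` maximises `E[U(V)]` among the feasible terminal values. -/
structure IsOptimalTerminalValue {Ω : Type*} (𝒢 : MeasurableSpace Ω)
    {mΩ : MeasurableSpace Ω} (Q : Measure Ω) (Z : Ω → ℝ) (v₀ : ℝ) (U : ℝ → ℝ) (V : Ω → ℝ) : Prop where
  feasible : IsFeasible 𝒢 Q Z v₀ V
  optimal : ∀ V', IsFeasible 𝒢 Q Z v₀ V' →
    extExpectation Q (fun ω => U (V' ω)) ≤ extExpectation Q (fun ω => U (V ω))

/-- `g` is a concave majorant of `U` on `[0, ∞)`. -/
def IsConcaveMajorant (U g : ℝ → ℝ) : Prop :=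
  ConcaveOn ℝ (Ici 0) g ∧ ∀ v, 0 ≤ v → U v ≤ g v

/-- The concave envelope on `[0, ∞)` of a function that is `-∞` on `(-∞, 0)`: the pointwise
infimum of its concave majorants. -/
def concaveEnvelope (U : ℝ → ℝ) (v : ℝ) : ℝ :=
  sInf {t | ∃ g, IsConcaveMajorant U g ∧ g v = t}

lemma concaveEnvelope_le {U g : ℝ → ℝ} (hg : IsConcaveMajorant U g) {v : ℝ} (hv : 0 ≤ v) :
    concaveEnvelope U v ≤ g v := by
  refine csInf_le ⟨U v, ?_⟩ ⟨g, hg, rfl⟩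
  rintro t ⟨g', hg', rfl⟩
  exact hg'.2 v hv

/-- As soon as a concave majorant exists, `concaveEnvelope U` is one; by `concaveEnvelope_le` it
is then the smallest. -/
lemma isConcaveMajorant_concaveEnvelope {U g : ℝ → ℝ} (hg : IsConcaveMajorant U g) :
    IsConcaveMajorant U (concaveEnvelope U) := by
  refine ⟨⟨convex_Ici 0, ?_⟩, ?_⟩
  · intro x hx y hy a b ha hb hab
    refine le_csInf ⟨_, g, hg, rfl⟩ ?_
    rintro t ⟨g', hg', rfl⟩
    refine le_trans ?_ (hg'.1.2 hx hy ha hb hab)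
    simp only [smul_eq_mul]
    have h1 := concaveEnvelope_le hg' (v := x) hx
    have h2 := concaveEnvelope_le hg' (v := y) hy
    gcongr
  · intro v hv
    refine le_csInf ⟨_, g, hg, rfl⟩ ?_
    rintro t ⟨g', hg', rfl⟩
    exact hg'.2 v hv

/-- The integrability condition: with `v y z` a maximiser of `u(v) - y z v` over `v ≥ 0`, where
`u` is the concave envelope of `U`, one has `E[Z v(y, Z)] < ∞` for every `y > 0`. -/
def IntegrabilityCondition {Ω : Type*} [MeasurableSpace Ω] (Q : Measure Ω) (Z : Ω → ℝ)
    (U : ℝ → ℝ) : Prop :=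
  ∃ v : ℝ → ℝ → ℝ,
    (∀ y > 0, ∀ z > 0, 0 ≤ v y z ∧
      IsMaxOn (fun x => concaveEnvelope U x - y * z * x) (Ici 0) (v y z)) ∧
    ∀ y > 0, ∫⁻ ω, ENNReal.ofReal (Z ω * v y (Z ω)) ∂Q < ∞

/-- A party's value function `φ(p) = E[U_p(V_p)]`, for utilities `U p` of the fund's terminal
value and a choice `V p` of the terminal value under each fee structure `p`. -/
def valueFunction {Ω : Type*} [MeasurableSpace Ω] (Q : Measure Ω) (U : Fee → ℝ → ℝ)
    (V : Fee → Ω → ℝ) (p : Fee) : ℝ := ∫ ω, U p (V p ω) ∂Q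

/-- `p` maximises `φI` over the fee structures in `P` with `φM ≥ φmin`. -/
structure SolvesParetoProblem (P : Set Fee) (φM φI : Fee → ℝ) (φmin : ℝ) (p : Fee) : Prop where
  mem : p ∈ P
  reservation : φmin ≤ φM p
  optimal : ∀ q ∈ P, φmin ≤ φM q → φI q ≤ φI p

end FirstLoss

end

open FirstLoss

namespace FirstLoss

/-! It suffices that both value functions are continuous on the compact set `P`: then `φ_M` attains
its extrema, its superlevel sets in `P` are compact, and `φ_I` has a maximum on each nonempty one.

For fixed fees the problem is solved by Lagrange duality. `U_M` is not concave, but the manager's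
payoff is a floor followed by a strictly increasing concave piece. Hence the maximisers of `U_M(v) -
s v` are unique except at no more than one slope `s > 0`, where they are `0` and one other point. A
measurable selection of maximisers at the slopes `y Z` that costs exactly `v₀` is optimal, and every
optimal value is such a selection (`IsLagrangeSolution.dominates`). A suitable `y` exists: if the
cost jumps across `v₀` at `y`, selections are mixed along the atomless variable `W_T`.

For continuity, multipliers along convergent fee structures subconverge in `(0, ∞)`, maximisers have
a closed graph, and dominated convergence applies. If `Z` is atomless, the exceptional slope is met
with probability zero. If `Z` is constant (`γ = 0`), optimal values need not be unique, but they
take at most two values and the budget fixes the probabilities; `exists_slope` covers both cases by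
subtracting a multiple of the cost.

The dominating function must serve all fees at once, although integrability is assumed for each fee
separately. `le_of_mem_maximizers_managerUtility` bounds all maximisers by those of a single fee
structure, and a Gaussian shift removes the weight `Z` from the integrability condition. -/

/-- The maximisers of `U(v) - s v` over `v ≥ 0`. -/
def maximizers (U : ℝ → ℝ) (s : ℝ) : Set ℝ :=
  {x | 0 ≤ x ∧ ∀ x', 0 ≤ x' → U x' - s * x' ≤ U x - s * x}

/-- The properties of a family of utilities of terminal wealth that the portfolio problem and its
stability depend on. -/
structure IsUtilityFamily {X : Type*} [TopologicalSpace X] (P : Set X) (U : X → ℝ → ℝ) :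
    Prop where
  continuousOn : ContinuousOn (fun q : X × ℝ => U q.1 q.2) (P ×ˢ Ici 0)
  sublinear : ∀ ε > 0, ∃ C, 0 ≤ C ∧ ∀ p ∈ P, ∀ v, 0 ≤ v → U p v ≤ C + ε * v
  bddBelow : ∃ c, 0 ≤ c ∧ ∀ p ∈ P, ∀ v, 0 ≤ v → -c ≤ U p v
  exists_gt : ∀ p ∈ P, ∀ v, 0 ≤ v → ∃ v', 0 ≤ v' ∧ U p v < U p v'
  eq_zero_of_lt : ∀ p ∈ P, ∀ s > 0, ∀ a ∈ maximizers (U p) s, ∀ b ∈ maximizers (U p) s,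
    a < b → a = 0

/-- Adding the two optimality inequalities gives `(t - s) * (x' - x) ≤ 0`. -/
lemma le_of_mem_maximizers {U : ℝ → ℝ} {s t x x' : ℝ} (hst : s < t)
    (hx : x ∈ maximizers U s) (hx' : x' ∈ maximizers U t) : x' ≤ x := by
  have h1 := hx.2 x' hx'.1
  have h2 := hx'.2 x hx.1
  nlinarith

lemma isConcaveMajorant_affine {U : ℝ → ℝ} {s x : ℝ} (hx : x ∈ maximizers U s) :
    IsConcaveMajorant U (fun v => U x + s * (v - x)) := by
  refine ⟨⟨convex_Ici 0, fun a _ b _ k l _ _ hkl => ?_⟩, fun v hv => ?_⟩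
  · simp only [smul_eq_mul]
    obtain rfl : l = 1 - k := by linarith
    apply le_of_eq; ring
  · linarith [hx.2 v hv]

/-- A maximiser for `U` lies below every maximiser for the concave envelope at a smaller slope. -/
lemma le_of_isMaxOn_concaveEnvelope {U : ℝ → ℝ} {s t x v : ℝ} (hts : t < s)
    (hx : x ∈ maximizers U s) (hv0 : 0 ≤ v)
    (hv : IsMaxOn (fun x => concaveEnvelope U x - t * x) (Ici 0) v) : x ≤ v := by
  -- The line of slope `s` through `x` lies above the envelope and touches it at `x`. Left of `x`
  -- the envelope therefore falls at rate at least `s > t`, and no point there is optimal at slope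
  -- `t`.
  have hm := isConcaveMajorant_affine hx
  have h1 := concaveEnvelope_le hm hv0
  have h2 := (isConcaveMajorant_concaveEnvelope hm).2 x hx.1
  have h3 : concaveEnvelope U x - t * x ≤ concaveEnvelope U v - t * v := hv (mem_Ici.2 hx.1)
  nlinarith

/-! ### Maximisers of `U p v - s v`: existence, stability and uniqueness -/

section Family

variable {X : Type*} [TopologicalSpace X] {P : Set X} {U : X → ℝ → ℝ}

lemma tendsto_of_continuousOn_prod {F : X → ℝ → ℝ}
    (hF : ContinuousOn (fun q : X × ℝ => F q.1 q.2) (P ×ˢ Ici 0)) {ι : Type*} {l : Filter ι}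
    {p : ι → X} {p₀ : X} (hp : ∀ n, p n ∈ P) (hp₀ : p₀ ∈ P) (hpt : Tendsto p l (𝓝 p₀))
    {x : ι → ℝ} {x₀ : ℝ} (hx : ∀ n, 0 ≤ x n) (hx₀ : 0 ≤ x₀) (hxt : Tendsto x l (𝓝 x₀)) :
    Tendsto (fun n => F (p n) (x n)) l (𝓝 (F p₀ x₀)) := by
  have h := hF (p₀, x₀) ⟨hp₀, hx₀⟩
  refine h.tendsto.comp (tendsto_nhdsWithin_iff.2 ⟨hpt.prodMk_nhds hxt, ?_⟩)
  exact Eventually.of_forall fun n => ⟨hp n, hx n⟩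

/-- Closed graph of the maximiser correspondence: the optimality inequality against a fixed
competitor passes to the limit. -/
lemma IsUtilityFamily.mem_maximizers_of_tendsto (hU : IsUtilityFamily P U) {ι : Type*}
    {l : Filter ι} [l.NeBot] {p : ι → X} {p₀ : X} (hp : ∀ n, p n ∈ P) (hp₀ : p₀ ∈ P)
    (hpt : Tendsto p l (𝓝 p₀)) {s : ι → ℝ} {s₀ : ℝ} (hst : Tendsto s l (𝓝 s₀))
    {x : ι → ℝ} {x₀ : ℝ} (hx : ∀ n, x n ∈ maximizers (U (p n)) (s n))
    (hxt : Tendsto x l (𝓝 x₀)) : x₀ ∈ maximizers (U p₀) s₀ := by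
  have hx₀ : 0 ≤ x₀ := ge_of_tendsto' hxt fun n => (hx n).1
  refine ⟨hx₀, fun x' hx' => ?_⟩
  have h1 := tendsto_of_continuousOn_prod hU.continuousOn hp hp₀ hpt (fun n => (hx n).1) hx₀ hxt
  have h2 := tendsto_of_continuousOn_prod hU.continuousOn hp hp₀ hpt (fun _ : ι => hx') hx'
    tendsto_const_nhds
  exact le_of_tendsto_of_tendsto' (h2.sub (hst.mul_const x')) (h1.sub (hst.mul hxt))
    fun n => (hx n).2 x' hx'

lemma IsUtilityFamily.maximizers_zero (hU : IsUtilityFamily P U) {p : X} (hp : p ∈ P) (x : ℝ) :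
    x ∉ maximizers (U p) 0 := by
  intro hx
  obtain ⟨v, hv, h⟩ := hU.exists_gt p hp x hx.1
  have := hx.2 v hv
  linarith

/-- A function that is constant on the set of limit maximisers converges along maximisers. -/
lemma IsUtilityFamily.tendsto_of_const_on_maximizers (hU : IsUtilityFamily P U)
    {p : ℕ → X} {p₀ : X} (hp : ∀ n, p n ∈ P) (hp₀ : p₀ ∈ P)
    (hpt : Tendsto p atTop (𝓝 p₀)) {s : ℕ → ℝ} {s₀ : ℝ} (hst : Tendsto s atTop (𝓝 s₀))
    {x : ℕ → ℝ} {R : ℝ} (hx : ∀ n, x n ∈ maximizers (U (p n)) (s n))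
    (hR : ∀ᶠ n in atTop, x n ≤ R) {F : X → ℝ → ℝ}
    (hF : ContinuousOn (fun q : X × ℝ => F q.1 q.2) (P ×ˢ Ici 0)) {c : ℝ}
    (hc : ∀ a ∈ maximizers (U p₀) s₀, F p₀ a = c) :
    Tendsto (fun n => F (p n) (x n)) atTop (𝓝 c) := by
  -- The maximisers themselves need not converge, but every subsequence has a further one that tends
  -- to some limit maximiser, and there `F p₀` equals `c`.
  refine tendsto_of_subseq_tendsto fun ns hns => ?_
  have hfr : ∃ᶠ n in atTop, x (ns n) ∈ Icc 0 R :=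
    ((hns.eventually hR).mono fun n hn => ⟨(hx (ns n)).1, hn⟩).frequently
  obtain ⟨a, -, φ, hφ, hlim⟩ := isCompact_Icc.tendsto_subseq' hfr
  have hn : Tendsto (fun n => ns (φ n)) atTop atTop := hns.comp hφ.tendsto_atTop
  have ha : a ∈ maximizers (U p₀) s₀ :=
    hU.mem_maximizers_of_tendsto (fun n => hp _) hp₀ (hpt.comp hn) (hst.comp hn)
      (fun n => hx (ns (φ n))) hlim
  refine ⟨φ, ?_⟩
  rw [← hc a ha]
  exact tendsto_of_continuousOn_prod hF (fun n => hp _) hp₀ (hpt.comp hn)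
    (fun n => (hx _).1) ha.1 hlim

/-- A bounded subsequence would have a limit point maximising `U p₀` at slope zero, but no member of
the family attains a maximum. -/
lemma IsUtilityFamily.tendsto_atTop_of_slope_tendsto_zero (hU : IsUtilityFamily P U)
    {p : ℕ → X} {p₀ : X} (hp : ∀ n, p n ∈ P) (hp₀ : p₀ ∈ P)
    (hpt : Tendsto p atTop (𝓝 p₀)) {s : ℕ → ℝ} (hst : Tendsto s atTop (𝓝 0))
    {x : ℕ → ℝ} (hx : ∀ n, x n ∈ maximizers (U (p n)) (s n)) : Tendsto x atTop atTop := by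
  rw [tendsto_atTop]
  by_contra! h
  obtain ⟨R, hR⟩ := h
  have hfr : ∃ᶠ n in atTop, x n ∈ Icc 0 R :=
    hR.mono fun n hn => ⟨(hx n).1, hn.le⟩
  obtain ⟨a, -, φ, hφ, hlim⟩ := isCompact_Icc.tendsto_subseq' hfr
  exact hU.maximizers_zero hp₀ a (hU.mem_maximizers_of_tendsto (fun n => hp _) hp₀
    (hpt.comp hφ.tendsto_atTop) (hst.comp hφ.tendsto_atTop) (fun n => hx (φ n)) hlim)

/-- Comparison of `x` with the competitor `0`. The constant depends on neither the parameter nor the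
slope. -/
lemma IsUtilityFamily.exists_mul_le (hU : IsUtilityFamily P U) {ε : ℝ} (hε : 0 < ε) :
    ∃ C, 0 ≤ C ∧ ∀ p ∈ P, ∀ s, ∀ x ∈ maximizers (U p) s, x * (s - ε) ≤ C := by
  obtain ⟨C, hC0, hC⟩ := hU.sublinear ε hε
  obtain ⟨c, hc0, hc⟩ := hU.bddBelow
  refine ⟨C + c, by linarith, fun p hp s x hx => ?_⟩
  have h1 := hx.2 0 le_rfl
  have h2 := hC p hp x hx.1
  have h3 := hc p hp 0 le_rfl
  nlinarith

lemma IsUtilityFamily.tendsto_zero_of_slope_tendsto_atTop (hU : IsUtilityFamily P U)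
    {p : ℕ → X} (hp : ∀ n, p n ∈ P) {s : ℕ → ℝ} (hst : Tendsto s atTop atTop)
    {x : ℕ → ℝ} (hx : ∀ n, x n ∈ maximizers (U (p n)) (s n)) : Tendsto x atTop (𝓝 0) := by
  obtain ⟨C, -, hC⟩ := hU.exists_mul_le one_pos
  have h1 : Tendsto (fun n => C / (s n - 1)) atTop (𝓝 0) :=
    (tendsto_atTop_add_const_right _ (-1 : ℝ) hst).const_div_atTop C
  refine tendsto_of_tendsto_of_tendsto_of_le_of_le' tendsto_const_nhds h1
    (Eventually.of_forall fun n => (hx n).1) ?_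
  filter_upwards [hst.eventually_gt_atTop 1] with n hn
  rw [le_div_iff₀ (by linarith)]
  exact hC _ (hp n) _ _ (hx n)

lemma IsUtilityFamily.continuousOn_apply (hU : IsUtilityFamily P U) {p : X} (hp : p ∈ P) :
    ContinuousOn (U p) (Ici 0) :=
  hU.continuousOn.comp (f := fun v : ℝ => (p, v)) (by fun_prop) fun _ hv => ⟨hp, hv⟩

lemma IsUtilityFamily.maximizers_nonempty (hU : IsUtilityFamily P U) {p : X} (hp : p ∈ P)
    {s : ℝ} (hs : 0 < s) : (maximizers (U p) s).Nonempty := by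
  obtain ⟨C, hC0, hC⟩ := hU.sublinear (s / 2) (by linarith)
  obtain ⟨c, hc0, hc⟩ := hU.bddBelow
  -- Beyond `R` the upper bound `C + s / 2 * v - s * v` drops below `-c ≤ U p 0`.
  set R := (C + c) * 2 / s with hR
  have hR0 : 0 ≤ R := by positivity
  have hcont : ContinuousOn (fun v => U p v - s * v) (Icc 0 R) :=
    ((hU.continuousOn_apply hp).mono Icc_subset_Ici_self).sub (by fun_prop)
  obtain ⟨x, hx, hmax⟩ := isCompact_Icc.exists_isMaxOn (nonempty_Icc.2 hR0) hcont
  refine ⟨x, hx.1, fun x' hx' => ?_⟩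
  rcases le_or_gt x' R with h | h
  · exact hmax (⟨hx', h⟩ : x' ∈ Icc 0 R)
  · have h0 : U p 0 - s * 0 ≤ U p x - s * x := hmax (⟨le_rfl, hR0⟩ : (0:ℝ) ∈ Icc 0 R)
    have h1 := hC p hp x' hx'
    have h2 := hc p hp 0 le_rfl
    rw [hR, div_lt_iff₀ hs] at h
    nlinarith

lemma IsUtilityFamily.isCompact_maximizers (hU : IsUtilityFamily P U) {p : X} (hp : p ∈ P)
    {s : ℝ} (hs : 0 < s) : IsCompact (maximizers (U p) s) := by
  obtain ⟨C, hC0, hC⟩ := hU.exists_mul_le (half_pos hs)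
  refine (isCompact_Icc (a := 0) (b := C / (s / 2))).of_isClosed_subset ?_ fun x hx =>
    ⟨hx.1, ?_⟩
  · refine isClosed_iff_clusterPt.2 fun a ha => ?_
    obtain ⟨x, hx, hxt⟩ := mem_closure_iff_seq_limit.1 (mem_closure_iff_clusterPt.2 ha)
    exact hU.mem_maximizers_of_tendsto (fun _ => hp) hp tendsto_const_nhds tendsto_const_nhds
      hx hxt
  · rw [le_div_iff₀ (half_pos hs)]
    have := hC p hp s x hx
    rwa [sub_half] at this

/-- The largest maximiser. -/
noncomputable def maxMaximizer (U : ℝ → ℝ) (s : ℝ) : ℝ := sSup (maximizers U s)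

/-- The smallest maximiser. -/
noncomputable def minMaximizer (U : ℝ → ℝ) (s : ℝ) : ℝ := sInf (maximizers U s)

lemma IsUtilityFamily.maxMaximizer_mem (hU : IsUtilityFamily P U) {p : X} (hp : p ∈ P)
    {s : ℝ} (hs : 0 < s) : maxMaximizer (U p) s ∈ maximizers (U p) s :=
  (hU.isCompact_maximizers hp hs).sSup_mem (hU.maximizers_nonempty hp hs)

lemma IsUtilityFamily.minMaximizer_mem (hU : IsUtilityFamily P U) {p : X} (hp : p ∈ P)
    {s : ℝ} (hs : 0 < s) : minMaximizer (U p) s ∈ maximizers (U p) s :=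
  (hU.isCompact_maximizers hp hs).sInf_mem (hU.maximizers_nonempty hp hs)

lemma IsUtilityFamily.le_maxMaximizer (hU : IsUtilityFamily P U) {p : X} (hp : p ∈ P)
    {s : ℝ} (hs : 0 < s) {x : ℝ} (hx : x ∈ maximizers (U p) s) : x ≤ maxMaximizer (U p) s :=
  le_csSup (hU.isCompact_maximizers hp hs).bddAbove hx

lemma IsUtilityFamily.minMaximizer_le (hU : IsUtilityFamily P U) {p : X} (hp : p ∈ P)
    {s : ℝ} (hs : 0 < s) {x : ℝ} (hx : x ∈ maximizers (U p) s) : minMaximizer (U p) s ≤ x :=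
  csInf_le (hU.isCompact_maximizers hp hs).bddBelow hx

/-- Every selection of maximisers is antitone in the slope, hence measurable. The exponential
parametrises the positive slopes, the only ones where `g` is controlled. -/
lemma measurable_of_mem_maximizers {U : ℝ → ℝ} {g : ℝ → ℝ}
    (hg : ∀ s, 0 < s → g s ∈ maximizers U s) : Measurable fun u => g (Real.exp u) := by
  refine Antitone.measurable fun a b hab => ?_
  rcases hab.eq_or_lt with rfl | h
  · exact le_rfl
  · exact le_of_mem_maximizers (Real.exp_lt_exp.2 h) (hg _ (Real.exp_pos a))
      (hg _ (Real.exp_pos b))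

lemma IsUtilityFamily.measurable_maxMaximizer_comp (hU : IsUtilityFamily P U) {p : X}
    (hp : p ∈ P) {Ω : Type*} [MeasurableSpace Ω] {f : Ω → ℝ} (hf : Measurable f)
    (hpos : ∀ ω, 0 < f ω) : Measurable fun ω => maxMaximizer (U p) (f ω) := by
  have h := (measurable_of_mem_maximizers fun s hs => hU.maxMaximizer_mem hp hs).comp
    (Real.measurable_log.comp hf)
  simpa [Function.comp_def, Real.exp_log (hpos _)] using h

lemma IsUtilityFamily.measurable_minMaximizer_comp (hU : IsUtilityFamily P U) {p : X}
    (hp : p ∈ P) {Ω : Type*} [MeasurableSpace Ω] {f : Ω → ℝ} (hf : Measurable f)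
    (hpos : ∀ ω, 0 < f ω) : Measurable fun ω => minMaximizer (U p) (f ω) := by
  have h := (measurable_of_mem_maximizers fun s hs => hU.minMaximizer_mem hp hs).comp
    (Real.measurable_log.comp hf)
  simpa [Function.comp_def, Real.exp_log (hpos _)] using h

/-- There is at most one slope with several maximisers. -/
lemma IsUtilityFamily.subsingleton_slopes (hU : IsUtilityFamily P U) {p : X} (hp : p ∈ P) :
    {s | 0 < s ∧ ¬ (maximizers (U p) s).Subsingleton}.Subsingleton := by
  -- The lower of two maximisers at slope `s` is `0`. Maximisers decrease in the slope, so at `t >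
  -- s` none can be positive.
  have key : ∀ s t, 0 < s → s < t → ¬ (maximizers (U p) s).Subsingleton →
      ¬ (maximizers (U p) t).Subsingleton → False := by
    intro s t hs hst h1 h2
    obtain ⟨a, ha, b, hb, hab⟩ := (not_subsingleton_iff.1 h1).exists_lt
    obtain ⟨a', ha', b', hb', hab'⟩ := (not_subsingleton_iff.1 h2).exists_lt
    have h3 := hU.eq_zero_of_lt p hp s hs a ha b hb hab
    have h4 := le_of_mem_maximizers hst ha hb'
    have h5 := ha'.1
    linarith
  rintro s ⟨hs, hs'⟩ t ⟨ht, ht'⟩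
  rcases lt_trichotomy s t with h | h | h
  · exact (key s t hs h hs' ht').elim
  · exact h
  · exact (key t s ht h ht' hs').elim

lemma IsUtilityFamily.eq_or_eq (hU : IsUtilityFamily P U) {p : X} (hp : p ∈ P) {s : ℝ}
    (hs : 0 < s) {a b c : ℝ} (ha : a ∈ maximizers (U p) s) (hb : b ∈ maximizers (U p) s)
    (hc : c ∈ maximizers (U p) s) (hab : a < b) : c = a ∨ c = b := by
  have h := hU.eq_zero_of_lt p hp s hs
  have ha0 := ha.1
  have h1 := h a ha b hb hab
  have hc0 := hc.1
  rcases lt_trichotomy c b with h2 | h2 | h2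
  · exact .inl ((h c hc b hb h2).trans h1.symm)
  · exact .inr h2
  · have := h b hb c hc h2
    linarith

end Family

/-! ### Selections of maximisers along a pricing kernel and their cost -/

/-- The properties of the state price density that the portfolio problem depends on: it is positive,
integrable, and either constant or atomless, on a `σ`-algebra that carries an atomless random
variable. -/
structure IsPricingKernel {Ω : Type*} (𝒢 : MeasurableSpace Ω) {mΩ : MeasurableSpace Ω}
    (Q : Measure Ω) (Z : Ω → ℝ) : Prop where
  le : 𝒢 ≤ mΩ
  measurable : Measurable[𝒢] Z
  pos : ∀ ω, 0 < Z ω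
  integrable : Integrable Z Q
  const_or_atomless : (∃ z, ∀ ω, Z ω = z) ∨ ∀ z, Q {ω | Z ω = z} = 0
  exists_atomless : ∃ Y : Ω → ℝ, Measurable[𝒢] Y ∧ ∀ a, Q {ω | Y ω = a} = 0

/-- Locally uniformly in the multiplier, the maximisers have an integrable bound. -/
def IsDominated {Ω X : Type*} {mΩ : MeasurableSpace Ω} (Q : Measure Ω) (Z : Ω → ℝ)
    (P : Set X) (U : X → ℝ → ℝ) : Prop :=
  ∀ y > 0, ∃ G : Ω → ℝ, Integrable G Q ∧ Integrable (fun ω => Z ω * G ω) Q ∧ (∀ ω, 0 ≤ G ω) ∧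
    ∀ p ∈ P, ∀ y' ≥ y, ∀ ω, ∀ x ∈ maximizers (U p) (y' * Z ω), x ≤ G ω

/-- `V` maximises the Lagrangian `U(V) - y Z V` pointwise. -/
def IsSelection {Ω : Type*} {mΩ : MeasurableSpace Ω} (Q : Measure Ω) (Z : Ω → ℝ) (U : ℝ → ℝ)
    (y : ℝ) (V : Ω → ℝ) : Prop :=
  ∀ᵐ ω ∂Q, V ω ∈ maximizers U (y * Z ω)

section

variable {Ω X : Type*} {P : Set X} {U : X → ℝ → ℝ}
  {𝒢 : MeasurableSpace Ω} {mΩ : MeasurableSpace Ω} {Q : Measure Ω} {Z : Ω → ℝ}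

lemma IsPricingKernel.measurable' (hZ : IsPricingKernel 𝒢 Q Z) : Measurable Z :=
  hZ.measurable.mono hZ.le le_rfl

lemma IsDominated.integrable (hZ : IsPricingKernel 𝒢 Q Z) (hG : IsDominated Q Z P U) {p : X}
    (hp : p ∈ P) {y : ℝ} (hy : 0 < y) {V : Ω → ℝ} (hVm : Measurable V)
    (hV : IsSelection Q Z (U p) y V) :
    Integrable V Q ∧ Integrable (fun ω => Z ω * V ω) Q := by
  obtain ⟨G, h1, h2, h3, h4⟩ := hG y hy
  have hb : ∀ᵐ ω ∂Q, 0 ≤ V ω ∧ V ω ≤ G ω :=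
    hV.mono fun ω h => ⟨h.1, h4 p hp y le_rfl ω _ h⟩
  constructor
  · refine h1.mono' hVm.aestronglyMeasurable (hb.mono fun ω h => ?_)
    rw [Real.norm_of_nonneg h.1]
    exact h.2
  · refine h2.mono' (hZ.measurable'.mul hVm).aestronglyMeasurable (hb.mono fun ω h => ?_)
    rw [Real.norm_of_nonneg (mul_nonneg (hZ.pos ω).le h.1)]
    exact mul_le_mul_of_nonneg_left h.2 (hZ.pos ω).le

/-- Mixing two maximisers of the Lagrangian meets any intermediate budget. -/
lemma IsDominated.exists_selection_integral_eq
    (hZ : IsPricingKernel 𝒢 Q Z) (hG : IsDominated Q Z P U) {p : X} (hp : p ∈ P)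
    {y : ℝ} (hy : 0 < y) {V₁ V₂ : Ω → ℝ} (hm₁ : Measurable[𝒢] V₁) (hm₂ : Measurable[𝒢] V₂)
    (h₁ : IsSelection Q Z (U p) y V₁) (h₂ : IsSelection Q Z (U p) y V₂) {b : ℝ}
    (hb₁ : ∫ ω, Z ω * V₁ ω ∂Q ≤ b) (hb₂ : b ≤ ∫ ω, Z ω * V₂ ω ∂Q) :
    ∃ V, Measurable[𝒢] V ∧ IsSelection Q Z (U p) y V ∧ ∫ ω, Z ω * V ω ∂Q = b := by
  rcases hb₁.eq_or_lt with e₁ | hb₁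
  · exact ⟨V₁, hm₁, h₁, e₁⟩
  rcases hb₂.eq_or_lt with e₂ | hb₂
  · exact ⟨V₂, hm₂, h₂, e₂.symm⟩
  -- Switch from `V₁` to `V₂` on `{Y < t}`. The cost is continuous in `t` because `Y` has no atoms,
  -- so the intermediate value theorem applies.
  obtain ⟨Y, hYm, hY⟩ := hZ.exists_atomless
  obtain ⟨G, -, hGi, hG0, hGb⟩ := hG y hy
  set V : ℝ → Ω → ℝ := fun t ω => if Y ω < t then V₂ ω else V₁ ω with hVdef
  have hVm : ∀ t, Measurable[𝒢] (V t) := fun t =>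
    Measurable.ite (hYm measurableSet_Iio) hm₂ hm₁
  have hVs : ∀ t, IsSelection Q Z (U p) y (V t) := fun t => by
    filter_upwards [h₁, h₂] with ω h h'
    simp only [hVdef]
    split_ifs
    · exact h'
    · exact h
  have hmeas : ∀ t, AEStronglyMeasurable (fun ω => Z ω * V t ω) Q := fun t =>
    (hZ.measurable'.mul ((hVm t).mono hZ.le le_rfl)).aestronglyMeasurable
  have hbound : ∀ t, ∀ᵐ ω ∂Q, ‖Z ω * V t ω‖ ≤ Z ω * G ω := fun t => by
    filter_upwards [hVs t] with ω hω
    rw [Real.norm_of_nonneg (mul_nonneg (hZ.pos ω).le hω.1)]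
    exact mul_le_mul_of_nonneg_left (hGb p hp y le_rfl ω _ hω) (hZ.pos ω).le
  have hcont : Continuous fun t => ∫ ω, Z ω * V t ω ∂Q := by
    refine continuous_iff_continuousAt.2 fun t => ?_
    refine tendsto_integral_filter_of_dominated_convergence (fun ω => Z ω * G ω)
      (Eventually.of_forall hmeas) (Eventually.of_forall hbound) hGi ?_
    have hne : ∀ᵐ ω ∂Q, Y ω ≠ t := by
      rw [ae_iff]
      simpa using hY t
    filter_upwards [hne] with ω hω
    refine tendsto_const_nhds.congr' ?_
    rcases lt_or_gt_of_ne hω with h | h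
    · filter_upwards [lt_mem_nhds h] with t' ht'
      simp [hVdef, h, ht']
    · filter_upwards [gt_mem_nhds h] with t' ht'
      simp [hVdef, not_lt.2 ht'.le, not_lt.2 h.le]
  have htop : Tendsto (fun t => ∫ ω, Z ω * V t ω ∂Q) atTop (𝓝 (∫ ω, Z ω * V₂ ω ∂Q)) := by
    refine tendsto_integral_filter_of_dominated_convergence (fun ω => Z ω * G ω)
      (Eventually.of_forall hmeas) (Eventually.of_forall hbound) hGi (ae_of_all _ fun ω => ?_)
    refine tendsto_const_nhds.congr' ?_
    filter_upwards [eventually_gt_atTop (Y ω)] with t' ht'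
    simp [hVdef, ht']
  have hbot : Tendsto (fun t => ∫ ω, Z ω * V t ω ∂Q) atBot (𝓝 (∫ ω, Z ω * V₁ ω ∂Q)) := by
    refine tendsto_integral_filter_of_dominated_convergence (fun ω => Z ω * G ω)
      (Eventually.of_forall hmeas) (Eventually.of_forall hbound) hGi (ae_of_all _ fun ω => ?_)
    refine tendsto_const_nhds.congr' ?_
    filter_upwards [eventually_le_atBot (Y ω)] with t' ht'
    simp [hVdef, not_lt.2 ht']
  obtain ⟨t₁, ht₁⟩ := (hbot.eventually_lt_const hb₁).exists
  obtain ⟨t₂, ht₂⟩ := (htop.eventually_const_lt hb₂).exists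
  obtain ⟨t, ht⟩ := mem_range_of_exists_le_of_exists_ge hcont ⟨t₁, ht₁.le⟩ ⟨t₂, ht₂.le⟩
  exact ⟨V t, hVm t, hVs t, ht⟩

variable [TopologicalSpace X]

/-- Stability of expectations along maximisers of the Lagrangian. -/
lemma IsUtilityFamily.tendsto_integral_of_const_on_maximizers [IsProbabilityMeasure Q]
    (hU : IsUtilityFamily P U) (hZ : IsPricingKernel 𝒢 Q Z) (hG : IsDominated Q Z P U)
    {p : ℕ → X} {p₀ : X} (hp : ∀ n, p n ∈ P) (hp₀ : p₀ ∈ P) (hpt : Tendsto p atTop (𝓝 p₀))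
    {y : ℕ → ℝ} {y₀ : ℝ} (hy₀ : 0 < y₀) (hyt : Tendsto y atTop (𝓝 y₀)) {V : ℕ → Ω → ℝ}
    (hV : ∀ n, IsSelection Q Z (U (p n)) (y n) (V n)) {F : Ω → X → ℝ → ℝ} {c : Ω → ℝ}
    (hFm : ∀ n, AEStronglyMeasurable (fun ω => F ω (p n) (V n ω)) Q)
    (hFc : ∀ ω, ContinuousOn (fun q : X × ℝ => F ω q.1 q.2) (P ×ˢ Ici 0))
    {a : ℝ} (ha : 0 ≤ a) {B : Ω → ℝ} (hB : Integrable B Q)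
    (hFb : ∀ ω, ∀ q ∈ P, ∀ v, 0 ≤ v → |F ω q v| ≤ a * ((1 + Z ω) * (1 + v)) + B ω)
    (hFconst : ∀ᵐ ω ∂Q, ∀ x ∈ maximizers (U p₀) (y₀ * Z ω), F ω p₀ x = c ω) :
    Tendsto (fun n => ∫ ω, F ω (p n) (V n ω) ∂Q) atTop (𝓝 (∫ ω, c ω ∂Q)) := by
  -- The bound at half the limit multiplier covers all late multipliers.
  obtain ⟨G, h1, h2, h3, h4⟩ := hG (y₀ / 2) (half_pos hy₀)
  have hy : ∀ᶠ n in atTop, y₀ / 2 ≤ y n :=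
    (hyt.eventually_const_lt (half_lt_self hy₀)).mono fun _ h => h.le
  refine tendsto_integral_filter_of_dominated_convergence
    (fun ω => a * ((1 + Z ω) * (1 + G ω)) + B ω) (Eventually.of_forall hFm) ?_ ?_ ?_
  · filter_upwards [hy] with n hn
    filter_upwards [hV n] with ω hω
    refine (hFb ω (p n) (hp n) _ hω.1).trans ?_
    have h5 := h4 (p n) (hp n) (y n) hn ω _ hω
    have := hZ.pos ω
    gcongr
  · have : (fun ω => a * ((1 + Z ω) * (1 + G ω)) + B ω)
        = fun ω => a * (1 + G ω + (Z ω + Z ω * G ω)) + B ω := by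
      ext ω; ring
    rw [this]
    exact ((((integrable_const 1).add h1).add (hZ.integrable.add h2)).const_mul a).add hB
  · filter_upwards [ae_all_iff.2 hV, hFconst] with ω hω hc
    refine hU.tendsto_of_const_on_maximizers hp hp₀ hpt (hyt.mul_const (Z ω)) hω
      (R := G ω) ?_ (hFc ω) hc
    filter_upwards [hy] with n hn
    exact h4 (p n) (hp n) (y n) hn ω _ (hω n)

/-- Fatou's lemma: as `y n → 0` the maximisers tend to infinity pointwise, so their costs cannot
stay bounded. -/
lemma IsUtilityFamily.not_tendsto_multiplier_zero [IsProbabilityMeasure Q]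
    (hU : IsUtilityFamily P U) (hZ : IsPricingKernel 𝒢 Q Z) (hG : IsDominated Q Z P U)
    {p : ℕ → X} {p₀ : X} (hp : ∀ n, p n ∈ P) (hp₀ : p₀ ∈ P) (hpt : Tendsto p atTop (𝓝 p₀))
    {y : ℕ → ℝ} (hy : ∀ n, 0 < y n) {V : ℕ → Ω → ℝ} (hVm : ∀ n, Measurable (V n))
    (hV : ∀ n, IsSelection Q Z (U (p n)) (y n) (V n)) {C : ℝ}
    (hC : ∀ n, ∫ ω, Z ω * V n ω ∂Q ≤ C) : ¬ Tendsto y atTop (𝓝 0) := by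
  intro hyt
  have hle : ∀ n, ∫⁻ ω, ENNReal.ofReal (Z ω * V n ω) ∂Q ≤ ENNReal.ofReal C := by
    intro n
    rw [← ofReal_integral_eq_lintegral_ofReal (hG.integrable hZ (hp n) (hy n) (hVm n) (hV n)).2]
    · exact ENNReal.ofReal_le_ofReal (hC n)
    · filter_upwards [hV n] with ω h using mul_nonneg (hZ.pos ω).le h.1
  have hF := lintegral_liminf_le (μ := Q) (u := atTop)
    (f := fun n ω => ENNReal.ofReal (Z ω * V n ω))
    fun n => (hZ.measurable'.mul (hVm n)).ennreal_ofReal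
  have htop : ∀ᵐ ω ∂Q, liminf (fun n => ENNReal.ofReal (Z ω * V n ω)) atTop = ∞ := by
    filter_upwards [ae_all_iff.2 hV] with ω hω
    have h0 : Tendsto (fun n => y n * Z ω) atTop (𝓝 0) := by simpa using hyt.mul_const (Z ω)
    have h1 := hU.tendsto_atTop_of_slope_tendsto_zero hp hp₀ hpt h0 hω
    exact (ENNReal.tendsto_ofReal_atTop.comp (h1.const_mul_atTop (hZ.pos ω))).liminf_eq
  rw [lintegral_congr_ae htop] at hF
  simp only [lintegral_const, measure_univ, mul_one, top_le_iff] at hF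
  have h2 : liminf (fun n => ∫⁻ ω, ENNReal.ofReal (Z ω * V n ω) ∂Q) atTop ≤ ENNReal.ofReal C :=
    liminf_le_of_le (by isBoundedDefault) fun b hb => by
      obtain ⟨n, hn⟩ := hb.exists
      exact hn.trans (hle n)
  rw [hF] at h2
  exact absurd h2 (by simp)

lemma IsUtilityFamily.tendsto_integral_of_multiplier_tendsto_atTop (hU : IsUtilityFamily P U)
    (hZ : IsPricingKernel 𝒢 Q Z) (hG : IsDominated Q Z P U)
    {p : ℕ → X} (hp : ∀ n, p n ∈ P) {y : ℕ → ℝ} (hy : Tendsto y atTop atTop)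
    {V : ℕ → Ω → ℝ} (hVm : ∀ n, Measurable (V n))
    (hV : ∀ n, IsSelection Q Z (U (p n)) (y n) (V n)) :
    Tendsto (fun n => ∫ ω, Z ω * V n ω ∂Q) atTop (𝓝 0) := by
  obtain ⟨G, h1, h2, h3, h4⟩ := hG 1 one_pos
  have h0 : (0 : ℝ) = ∫ _, (0 : ℝ) ∂Q := by simp
  rw [h0]
  refine tendsto_integral_filter_of_dominated_convergence (fun ω => Z ω * G ω)
    (Eventually.of_forall fun n => (hZ.measurable'.mul (hVm n)).aestronglyMeasurable) ?_ h2 ?_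
  · filter_upwards [hy.eventually_ge_atTop 1] with n hn
    filter_upwards [hV n] with ω hω
    rw [Real.norm_of_nonneg (mul_nonneg (hZ.pos ω).le hω.1)]
    exact mul_le_mul_of_nonneg_left (h4 _ (hp n) _ hn ω _ hω) (hZ.pos ω).le
  · filter_upwards [ae_all_iff.2 hV] with ω hω
    simpa using (hU.tendsto_zero_of_slope_tendsto_atTop hp (hy.atTop_mul_const (hZ.pos ω))
      hω).const_mul (Z ω)

/-- Upper semicontinuity of the cost. The excess `Z (v - g)⁺` over the largest limit maximiser `g`
vanishes on all limit maximisers, so its expectation tends to zero even where the `V n` do not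
converge. -/
lemma IsUtilityFamily.le_integral_maxMaximizer [IsProbabilityMeasure Q]
    (hU : IsUtilityFamily P U) (hZ : IsPricingKernel 𝒢 Q Z) (hG : IsDominated Q Z P U)
    {p : ℕ → X} {p₀ : X} (hp : ∀ n, p n ∈ P) (hp₀ : p₀ ∈ P) (hpt : Tendsto p atTop (𝓝 p₀))
    {y : ℕ → ℝ} (hy : ∀ n, 0 < y n) {y₀ : ℝ} (hy₀ : 0 < y₀) (hyt : Tendsto y atTop (𝓝 y₀))
    {V : ℕ → Ω → ℝ} (hVm : ∀ n, Measurable (V n))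
    (hV : ∀ n, IsSelection Q Z (U (p n)) (y n) (V n)) {b : ℝ}
    (hb : ∀ n, b ≤ ∫ ω, Z ω * V n ω ∂Q) :
    b ≤ ∫ ω, Z ω * maxMaximizer (U p₀) (y₀ * Z ω) ∂Q := by
  have hpos : ∀ ω, 0 < y₀ * Z ω := fun ω => mul_pos hy₀ (hZ.pos ω)
  set g : Ω → ℝ := fun ω => maxMaximizer (U p₀) (y₀ * Z ω) with hg
  have hgm : Measurable g :=
    hU.measurable_maxMaximizer_comp hp₀ (hZ.measurable'.const_mul y₀) hpos
  have hgs : IsSelection Q Z (U p₀) y₀ g := ae_of_all _ fun ω => hU.maxMaximizer_mem hp₀ (hpos ω)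
  have hgi := (hG.integrable hZ hp₀ hy₀ hgm hgs).2
  have hg0 : ∀ ω, 0 ≤ g ω := fun ω => (hU.maxMaximizer_mem hp₀ (hpos ω)).1
  have hlim := hU.tendsto_integral_of_const_on_maximizers hZ hG hp hp₀ hpt hy₀ hyt hV
    (F := fun ω _ v => Z ω * max (v - g ω) 0) (c := fun _ => 0)
    (fun n => (hZ.measurable'.mul
      (((hVm n).sub hgm).max measurable_const)).aestronglyMeasurable)
    (fun ω => by fun_prop) zero_le_one (integrable_zero _ _ _) (fun ω q _ v hv => by
      have h1 := hZ.pos ω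
      have h2 : max (v - g ω) 0 ≤ v := max_le (by linarith [hg0 ω]) hv
      have h3 : 0 ≤ max (v - g ω) 0 := le_max_right _ _
      rw [abs_of_nonneg (by positivity)]
      simp only [Pi.zero_apply]
      nlinarith)
    (ae_of_all _ fun ω x hx => by
      rw [max_eq_right (sub_nonpos.2 (hU.le_maxMaximizer hp₀ (hpos ω) hx)), mul_zero])
  simp only [integral_zero] at hlim
  have h2 : ∀ n, b - ∫ ω, Z ω * g ω ∂Q ≤ ∫ ω, Z ω * max (V n ω - g ω) 0 ∂Q := by
    intro n
    have hVi := (hG.integrable hZ (hp n) (hy n) (hVm n) (hV n)).2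
    refine (sub_le_sub_right (hb n) _).trans ?_
    rw [← integral_sub hVi hgi]
    have hi : Integrable (fun ω => Z ω * V n ω - Z ω * g ω) Q := hVi.sub hgi
    have hmax : (fun ω => Z ω * max (V n ω - g ω) 0)
        = fun ω => max (Z ω * V n ω - Z ω * g ω) 0 := by
      ext ω
      rw [mul_max_of_nonneg _ _ (hZ.pos ω).le, mul_sub, mul_zero]
    rw [hmax]
    exact integral_mono hi hi.pos_part fun ω => le_max_left _ _
  have := ge_of_tendsto' hlim h2
  linarith

/-- The mirror image, with the shortfall `Z (g - v)⁺`, which is dominated by `Z g`. -/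
lemma IsUtilityFamily.integral_minMaximizer_le [IsProbabilityMeasure Q]
    (hU : IsUtilityFamily P U) (hZ : IsPricingKernel 𝒢 Q Z) (hG : IsDominated Q Z P U)
    {p : ℕ → X} {p₀ : X} (hp : ∀ n, p n ∈ P) (hp₀ : p₀ ∈ P) (hpt : Tendsto p atTop (𝓝 p₀))
    {y : ℕ → ℝ} (hy : ∀ n, 0 < y n) {y₀ : ℝ} (hy₀ : 0 < y₀) (hyt : Tendsto y atTop (𝓝 y₀))
    {V : ℕ → Ω → ℝ} (hVm : ∀ n, Measurable (V n))
    (hV : ∀ n, IsSelection Q Z (U (p n)) (y n) (V n)) {b : ℝ}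
    (hb : ∀ n, ∫ ω, Z ω * V n ω ∂Q ≤ b) :
    ∫ ω, Z ω * minMaximizer (U p₀) (y₀ * Z ω) ∂Q ≤ b := by
  have hpos : ∀ ω, 0 < y₀ * Z ω := fun ω => mul_pos hy₀ (hZ.pos ω)
  set g : Ω → ℝ := fun ω => minMaximizer (U p₀) (y₀ * Z ω) with hg
  have hgm : Measurable g :=
    hU.measurable_minMaximizer_comp hp₀ (hZ.measurable'.const_mul y₀) hpos
  have hgs : IsSelection Q Z (U p₀) y₀ g := ae_of_all _ fun ω => hU.minMaximizer_mem hp₀ (hpos ω)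
  have hgi := (hG.integrable hZ hp₀ hy₀ hgm hgs).2
  have hg0 : ∀ ω, 0 ≤ g ω := fun ω => (hU.minMaximizer_mem hp₀ (hpos ω)).1
  have hlim := hU.tendsto_integral_of_const_on_maximizers hZ hG hp hp₀ hpt hy₀ hyt hV
    (F := fun ω _ v => Z ω * max (g ω - v) 0) (c := fun _ => 0)
    (fun n => (hZ.measurable'.mul
      ((hgm.sub (hVm n)).max measurable_const)).aestronglyMeasurable)
    (fun ω => by fun_prop) le_rfl hgi (fun ω q _ v hv => by
      have h1 := hZ.pos ω
      have h2 : max (g ω - v) 0 ≤ g ω := max_le (by linarith) (hg0 ω)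
      have h3 : 0 ≤ max (g ω - v) 0 := le_max_right _ _
      rw [abs_of_nonneg (by positivity), zero_mul, zero_add]
      exact mul_le_mul_of_nonneg_left h2 h1.le)
    (ae_of_all _ fun ω x hx => by
      rw [max_eq_right (sub_nonpos.2 (hU.minMaximizer_le hp₀ (hpos ω) hx)), mul_zero])
  simp only [integral_zero] at hlim
  have h2 : ∀ n, ∫ ω, Z ω * g ω ∂Q - b ≤ ∫ ω, Z ω * max (g ω - V n ω) 0 ∂Q := by
    intro n
    have hVi := (hG.integrable hZ (hp n) (hy n) (hVm n) (hV n)).2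
    refine (sub_le_sub_left (hb n) _).trans ?_
    rw [← integral_sub hgi hVi]
    have hi : Integrable (fun ω => Z ω * g ω - Z ω * V n ω) Q := hgi.sub hVi
    have hmax : (fun ω => Z ω * max (g ω - V n ω) 0)
        = fun ω => max (Z ω * g ω - Z ω * V n ω) 0 := by
      ext ω
      rw [mul_max_of_nonneg _ _ (hZ.pos ω).le, mul_sub, mul_zero]
    rw [hmax]
    exact integral_mono hi hi.pos_part fun ω => le_max_left _ _
  have := ge_of_tendsto' hlim h2
  linarith

end

/-! ### Lagrange solutions, optimal terminal values and their stability -/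

/-- `V` maximises the Lagrangian with multiplier `y` and exhausts the budget `b`. -/
structure IsLagrangeSolution {Ω : Type*} (𝒢 : MeasurableSpace Ω) {mΩ : MeasurableSpace Ω}
    (Q : Measure Ω) (Z : Ω → ℝ) (b : ℝ) (U : ℝ → ℝ) (y : ℝ) (V : Ω → ℝ) : Prop where
  measurable : Measurable[𝒢] V
  selection : IsSelection Q Z U y V
  integral_eq : ∫ ω, Z ω * V ω ∂Q = b

section

variable {Ω X : Type*} {P : Set X} {U : X → ℝ → ℝ}
  {𝒢 : MeasurableSpace Ω} {mΩ : MeasurableSpace Ω} {Q : Measure Ω} {Z : Ω → ℝ} {b : ℝ}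

lemma extExpectation_of_integrable {f : Ω → ℝ} (hf : Integrable f Q) :
    extExpectation Q f = ((∫ ω, f ω ∂Q : ℝ) : EReal) := by
  have hneg : Integrable (fun ω => -f ω) Q := hf.neg
  rw [integral_eq_lintegral_pos_part_sub_lintegral_neg_part hf, EReal.coe_sub, extExpectation]
  rw [EReal.coe_ennreal_toReal hf.lintegral_lt_top.ne,
    EReal.coe_ennreal_toReal hneg.lintegral_lt_top.ne]

lemma aestronglyMeasurable_comp_of_continuousOn {f : ℝ → ℝ} (hf : ContinuousOn f (Ici 0))
    {V : Ω → ℝ} (hVm : Measurable V) (hV : ∀ᵐ ω ∂Q, 0 ≤ V ω) :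
    AEStronglyMeasurable (fun ω => f (V ω)) Q := by
  have h : Continuous fun v : ℝ => f (max v 0) :=
    hf.comp_continuous (by fun_prop) fun v => le_max_right v 0
  refine ((h.measurable.comp hVm).aestronglyMeasurable (μ := Q)).congr ?_
  filter_upwards [hV] with ω hω
  simp [max_eq_left hω]

lemma IsFeasible.integrable_mul (hZ : IsPricingKernel 𝒢 Q Z) (hb : 0 ≤ b) {V : Ω → ℝ}
    (hV : IsFeasible 𝒢 Q Z b V) :
    Integrable (fun ω => Z ω * V ω) Q ∧ ∫ ω, Z ω * V ω ∂Q ≤ b := by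
  have h0 : 0 ≤ᵐ[Q] fun ω => Z ω * V ω := hV.nonneg.mono fun ω h => mul_nonneg (hZ.pos ω).le h
  have hm : AEStronglyMeasurable (fun ω => Z ω * V ω) Q :=
    (hZ.measurable'.mul (hV.measurable.mono hZ.le le_rfl)).aestronglyMeasurable
  constructor
  · exact (lintegral_ofReal_ne_top_iff_integrable hm h0).1
      (hV.budget.trans_lt ENNReal.ofReal_lt_top).ne
  · rw [integral_eq_lintegral_of_nonneg_ae h0 hm]
    exact ENNReal.toReal_le_of_le_ofReal hb hV.budget

lemma IsLagrangeSolution.isFeasible (hZ : IsPricingKernel 𝒢 Q Z) (hG : IsDominated Q Z P U)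
    {p : X} (hp : p ∈ P) {y : ℝ} (hy : 0 < y) {V : Ω → ℝ}
    (hV : IsLagrangeSolution 𝒢 Q Z b (U p) y V) : IsFeasible 𝒢 Q Z b V := by
  refine ⟨hV.measurable, hV.selection.mono fun _ h => h.1, ?_⟩
  have hi := (hG.integrable hZ hp hy (hV.measurable.mono hZ.le le_rfl) hV.selection).2
  rw [← ofReal_integral_eq_lintegral_ofReal hi, hV.integral_eq]
  exact hV.selection.mono fun ω h => mul_nonneg (hZ.pos ω).le h.1

lemma integrable_comp_of_abs_le {f : ℝ → ℝ} (hf : ContinuousOn f (Ici 0)) {a : ℝ}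
    (ha : ∀ v, 0 ≤ v → |f v| ≤ a * (1 + v)) [IsProbabilityMeasure Q] {V : Ω → ℝ}
    (hVm : Measurable V) (hV : ∀ᵐ ω ∂Q, 0 ≤ V ω) (hVi : Integrable V Q) :
    Integrable (fun ω => f (V ω)) Q :=
  (((integrable_const 1).add hVi).const_mul a).mono'
    (aestronglyMeasurable_comp_of_continuousOn hf hVm hV) (hV.mono fun _ h => ha _ h)

/-- For a given multiplier, expectations can be made insensitive to the choice of the maximiser by
subtracting a multiple of the budget. -/
lemma IsUtilityFamily.exists_slope [TopologicalSpace X] (hU : IsUtilityFamily P U)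
    (hZ : IsPricingKernel 𝒢 Q Z) {p : X} (hp : p ∈ P) {y : ℝ} (hy : 0 < y) (f : ℝ → ℝ) :
    ∃ κ : ℝ, ∀ᵐ ω ∂Q, ∀ a ∈ maximizers (U p) (y * Z ω), ∀ a' ∈ maximizers (U p) (y * Z ω),
      f a - κ * (Z ω * a) = f a' - κ * (Z ω * a') := by
  rcases hZ.const_or_atomless with ⟨z, hz⟩ | hat
  · by_cases hs : (maximizers (U p) (y * z)).Subsingleton
    · refine ⟨0, ae_of_all _ fun ω a ha a' ha' => ?_⟩
      rw [hz] at ha ha'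
      rw [hs ha ha']
    · obtain ⟨k, hk, l, hl, hkl⟩ := (not_subsingleton_iff.1 hs).exists_lt
      -- With constant price `z` only `k` and `l` are maximisers; this `κ` is the increment of `f`
      -- per unit of cost between them.
      refine ⟨(f l - f k) / (z * (l - k)), ae_of_all _ fun ω => ?_⟩
      have hz0 : 0 < z := hz ω ▸ hZ.pos ω
      have hlk : 0 < l - k := sub_pos.2 hkl
      have key : ∀ a ∈ maximizers (U p) (y * z),
          f a - (f l - f k) / (z * (l - k)) * (z * a)
            = f k - (f l - f k) / (z * (l - k)) * (z * k) := by
        intro a ha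
        rcases hU.eq_or_eq hp (mul_pos hy hz0) hk hl ha hkl with rfl | rfl
        · rfl
        · field_simp
          ring
      rw [hz]
      intro a ha a' ha'
      rw [key a ha, key a' ha']
  -- For atomless `Z` the single exceptional slope is met with probability zero, so no correction is
  -- needed.
  · refine ⟨0, ?_⟩
    have hss := hU.subsingleton_slopes hp
    have hae : ∀ᵐ ω ∂Q, (maximizers (U p) (y * Z ω)).Subsingleton := by
      rcases hss.eq_empty_or_singleton with h | ⟨s, h⟩
      · refine ae_of_all _ fun ω => ?_
        by_contra hn
        exact notMem_empty (y * Z ω) (h.subset ⟨mul_pos hy (hZ.pos ω), hn⟩)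
      · have hne : ∀ᵐ ω ∂Q, Z ω ≠ s / y := by
          rw [ae_iff]
          simpa using hat (s / y)
        filter_upwards [hne] with ω hω
        by_contra hn
        have hmem : y * Z ω ∈ {s | 0 < s ∧ ¬ (maximizers (U p) s).Subsingleton} :=
          ⟨mul_pos hy (hZ.pos ω), hn⟩
        rw [h, mem_singleton_iff] at hmem
        exact hω (by rw [← hmem]; field_simp)
    filter_upwards [hae] with ω hω a ha a' ha'
    rw [hω ha ha']

variable [TopologicalSpace X]

lemma IsUtilityFamily.exists_abs_le (hU : IsUtilityFamily P U) :
    ∃ a, 0 ≤ a ∧ ∀ p ∈ P, ∀ v, 0 ≤ v → |U p v| ≤ a * (1 + v) := by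
  obtain ⟨C, hC0, hC⟩ := hU.sublinear 1 one_pos
  obtain ⟨c, hc0, hc⟩ := hU.bddBelow
  refine ⟨C + c + 1, by linarith, fun p hp v hv => abs_le.2 ⟨?_, ?_⟩⟩
  · have := hc p hp v hv
    nlinarith
  · have := hC p hp v hv
    nlinarith

variable [IsProbabilityMeasure Q]

/-- A solution of the Lagrange problem dominates every feasible terminal value, and any feasible
terminal value that is as good is itself a solution with the same multiplier. -/
lemma IsLagrangeSolution.dominates (hU : IsUtilityFamily P U)
    (hZ : IsPricingKernel 𝒢 Q Z) (hG : IsDominated Q Z P U) (hb : 0 ≤ b)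
    {p : X} (hp : p ∈ P) {y : ℝ} (hy : 0 < y) {V V' : Ω → ℝ}
    (hV : IsLagrangeSolution 𝒢 Q Z b (U p) y V) (hV' : IsFeasible 𝒢 Q Z b V') :
    Integrable (fun ω => U p (V' ω)) Q ∧ ∫ ω, U p (V' ω) ∂Q ≤ ∫ ω, U p (V ω) ∂Q ∧
      (∫ ω, U p (V' ω) ∂Q = ∫ ω, U p (V ω) ∂Q → IsLagrangeSolution 𝒢 Q Z b (U p) y V') := by
  obtain ⟨a, ha0, ha⟩ := hU.exists_abs_le
  have hcont := hU.continuousOn_apply hp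
  have hVm := hV.measurable.mono hZ.le le_rfl
  have hV'm := hV'.measurable.mono hZ.le le_rfl
  obtain ⟨hVi, hZV⟩ := hG.integrable hZ hp hy hVm hV.selection
  obtain ⟨hZV', hle⟩ := hV'.integrable_mul hZ hb
  have hUV := integrable_comp_of_abs_le hcont (ha p hp) hVm
    (hV.selection.mono fun ω h => h.1) hVi
  have hpt : ∀ᵐ ω ∂Q, U p (V' ω) ≤ U p (V ω) - y * (Z ω * V ω) + y * (Z ω * V' ω) := by
    filter_upwards [hV.selection, hV'.nonneg] with ω h h'
    linarith [h.2 _ h']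
  have hR : Integrable (fun ω => U p (V ω) - y * (Z ω * V ω) + y * (Z ω * V' ω)) Q :=
    (hUV.sub (hZV.const_mul y)).add (hZV'.const_mul y)
  have hRint : ∫ ω, (U p (V ω) - y * (Z ω * V ω) + y * (Z ω * V' ω)) ∂Q
      = ∫ ω, U p (V ω) ∂Q - y * b + y * ∫ ω, Z ω * V' ω ∂Q := by
    have hd : Integrable (fun ω => U p (V ω) - y * (Z ω * V ω)) Q := hUV.sub (hZV.const_mul y)
    rw [integral_add hd (hZV'.const_mul y), integral_sub hUV (hZV.const_mul y), integral_const_mul, integral_const_mul,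
      hV.integral_eq]
  obtain ⟨c, hc0, hc⟩ := hU.bddBelow
  have hUV' : Integrable (fun ω => U p (V' ω)) Q :=
    integrable_of_le_of_le (aestronglyMeasurable_comp_of_continuousOn hcont hV'm hV'.nonneg)
      (hV'.nonneg.mono fun ω h => hc p hp _ h) hpt (integrable_const _) hR
  have hmono := integral_mono_ae hUV' hR hpt
  rw [hRint] at hmono
  have hyle : y * ∫ ω, Z ω * V' ω ∂Q ≤ y * b := mul_le_mul_of_nonneg_left hle hy.le
  refine ⟨hUV', by linarith, fun heq => ?_⟩
  -- Equal expectations leave no slack: the budget binds because `y > 0`, and the pointwise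
  -- Lagrangian bound is an equality almost surely.
  have hZb : ∫ ω, Z ω * V' ω ∂Q = b :=
    le_antisymm hle (le_of_mul_le_mul_left (by linarith) hy)
  refine ⟨hV'.measurable, ?_, hZb⟩
  have hae : (fun ω => U p (V' ω))
      =ᵐ[Q] fun ω => U p (V ω) - y * (Z ω * V ω) + y * (Z ω * V' ω) := by
    refine (integral_eq_iff_of_ae_le hUV' hR hpt).1 ?_
    rw [hRint, hZb, heq]
    ring
  filter_upwards [hae, hV.selection, hV'.nonneg] with ω h1 h2 h3
  refine ⟨h3, fun x hx => ?_⟩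
  have := h2.2 x hx
  linarith

lemma IsLagrangeSolution.isOptimalTerminalValue (hU : IsUtilityFamily P U)
    (hZ : IsPricingKernel 𝒢 Q Z) (hG : IsDominated Q Z P U) (hb : 0 ≤ b)
    {p : X} (hp : p ∈ P) {y : ℝ} (hy : 0 < y) {V : Ω → ℝ}
    (hV : IsLagrangeSolution 𝒢 Q Z b (U p) y V) :
    IsOptimalTerminalValue 𝒢 Q Z b (U p) V := by
  have hf := hV.isFeasible hZ hG hp hy
  refine ⟨hf, fun V' hV' => ?_⟩
  obtain ⟨h1, h2, -⟩ := hV.dominates hU hZ hG hb hp hy hV'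
  rw [extExpectation_of_integrable h1,
    extExpectation_of_integrable (hV.dominates hU hZ hG hb hp hy hf).1]
  exact EReal.coe_le_coe_iff.2 h2

lemma IsLagrangeSolution.of_isOptimalTerminalValue (hU : IsUtilityFamily P U)
    (hZ : IsPricingKernel 𝒢 Q Z) (hG : IsDominated Q Z P U) (hb : 0 ≤ b)
    {p : X} (hp : p ∈ P) {y : ℝ} (hy : 0 < y) {V V' : Ω → ℝ}
    (hV : IsLagrangeSolution 𝒢 Q Z b (U p) y V)
    (hV' : IsOptimalTerminalValue 𝒢 Q Z b (U p) V') :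
    IsLagrangeSolution 𝒢 Q Z b (U p) y V' := by
  have hf := hV.isFeasible hZ hG hp hy
  obtain ⟨h1, h2, h3⟩ := hV.dominates hU hZ hG hb hp hy hV'.feasible
  refine h3 (le_antisymm h2 ?_)
  have h := hV'.optimal V hf
  rw [extExpectation_of_integrable h1,
    extExpectation_of_integrable (hV.dominates hU hZ hG hb hp hy hf).1] at h
  exact EReal.coe_le_coe_iff.1 h

/-- Expectations converge along solutions of the Lagrange problems. -/
lemma IsUtilityFamily.tendsto_integral_lagrangeSolution (hU : IsUtilityFamily P U)
    (hZ : IsPricingKernel 𝒢 Q Z) (hG : IsDominated Q Z P U)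
    {p : ℕ → X} {p₀ : X} (hp : ∀ n, p n ∈ P) (hp₀ : p₀ ∈ P) (hpt : Tendsto p atTop (𝓝 p₀))
    {y : ℕ → ℝ} (hy : ∀ n, 0 < y n) {y₀ : ℝ} (hy₀ : 0 < y₀) (hyt : Tendsto y atTop (𝓝 y₀))
    {V : ℕ → Ω → ℝ} (hV : ∀ n, IsLagrangeSolution 𝒢 Q Z b (U (p n)) (y n) (V n))
    {V₀ : Ω → ℝ} (hV₀ : IsLagrangeSolution 𝒢 Q Z b (U p₀) y₀ V₀) {F : X → ℝ → ℝ}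
    (hF : ContinuousOn (fun q : X × ℝ => F q.1 q.2) (P ×ˢ Ici 0)) {a : ℝ} (ha : 0 ≤ a)
    (hFa : ∀ p ∈ P, ∀ v, 0 ≤ v → |F p v| ≤ a * (1 + v)) :
    Tendsto (fun n => ∫ ω, F (p n) (V n ω) ∂Q) atTop (𝓝 (∫ ω, F p₀ (V₀ ω) ∂Q)) := by
  -- The integrand `F - κ Z v` is constant on the limit maximisers. Since every solution costs
  -- exactly `b`, the correction shifts all integrals by the same `κ * b`.
  obtain ⟨κ, hκ⟩ := hU.exists_slope hZ hp₀ hy₀ (F p₀)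
  have hVm := fun n => (hV n).measurable.mono hZ.le le_rfl
  have hFcont : ∀ p ∈ P, ContinuousOn (F p) (Ici 0) := fun p hp =>
    hF.comp (f := fun v : ℝ => (p, v)) (by fun_prop) fun _ hv => ⟨hp, hv⟩
  have hsub : ∀ {q : X} {t : ℝ} {V : Ω → ℝ}, q ∈ P → 0 < t →
      IsLagrangeSolution 𝒢 Q Z b (U q) t V →
      ∫ ω, (F q (V ω) - κ * (Z ω * V ω)) ∂Q = ∫ ω, F q (V ω) ∂Q - κ * b := by
    intro q t V hq ht hV
    have hm := hV.measurable.mono hZ.le le_rfl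
    obtain ⟨h1, h2⟩ := hG.integrable hZ hq ht hm hV.selection
    rw [integral_sub (integrable_comp_of_abs_le (hFcont q hq) (hFa q hq) hm
      (hV.selection.mono fun ω h => h.1) h1) (h2.const_mul κ), integral_const_mul, hV.integral_eq]
  have hlim := hU.tendsto_integral_of_const_on_maximizers hZ hG hp hp₀ hpt hy₀ hyt
    (fun n => (hV n).selection) (F := fun ω q v => F q v - κ * (Z ω * v))
    (c := fun ω => F p₀ (V₀ ω) - κ * (Z ω * V₀ ω)) (a := a + |κ|)
    (fun n => (aestronglyMeasurable_comp_of_continuousOn (hFcont _ (hp n)) (hVm n)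
      ((hV n).selection.mono fun ω h => h.1)).sub
      ((hZ.measurable'.mul (hVm n)).const_mul κ).aestronglyMeasurable)
    (fun ω => hF.sub (by fun_prop)) (by positivity) (integrable_zero _ _ _)
    (fun ω q hq v hv => by
      have h1 := hZ.pos ω
      have h2 := hFa q hq v hv
      refine (abs_sub _ _).trans ?_
      rw [abs_mul, abs_of_nonneg (mul_nonneg h1.le hv)]
      have h3 : a * (1 + v) ≤ a * ((1 + Z ω) * (1 + v)) :=
        mul_le_mul_of_nonneg_left (by nlinarith) ha
      have h4 : |κ| * (Z ω * v) ≤ |κ| * ((1 + Z ω) * (1 + v)) :=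
        mul_le_mul_of_nonneg_left (by nlinarith) (abs_nonneg κ)
      simp only [Pi.zero_apply]
      linarith)
    (by
      filter_upwards [hκ, hV₀.selection] with ω h h' x hx
      exact h x hx _ h')
  rw [hsub hp₀ hy₀ hV₀] at hlim
  have heq : (fun n => ∫ ω, (F (p n) (V n ω) - κ * (Z ω * V n ω)) ∂Q)
      = fun n => ∫ ω, F (p n) (V n ω) ∂Q - κ * b := funext fun n => hsub (hp n) (hy n) (hV n)
  rw [heq] at hlim
  simpa using hlim.add_const (κ * b)

/-- Limits of multipliers are multipliers. -/
lemma IsUtilityFamily.exists_lagrangeSolution_of_tendsto (hU : IsUtilityFamily P U)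
    (hZ : IsPricingKernel 𝒢 Q Z) (hG : IsDominated Q Z P U)
    {p p' : ℕ → X} {p₀ : X} (hp : ∀ n, p n ∈ P) (hp' : ∀ n, p' n ∈ P) (hp₀ : p₀ ∈ P)
    (hpt : Tendsto p atTop (𝓝 p₀)) (hpt' : Tendsto p' atTop (𝓝 p₀))
    {y y' : ℕ → ℝ} (hy : ∀ n, 0 < y n) (hy' : ∀ n, 0 < y' n) {y₀ : ℝ} (hy₀ : 0 < y₀)
    (hyt : Tendsto y atTop (𝓝 y₀)) (hyt' : Tendsto y' atTop (𝓝 y₀))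
    {V V' : ℕ → Ω → ℝ} (hVm : ∀ n, Measurable (V n)) (hVm' : ∀ n, Measurable (V' n))
    (hV : ∀ n, IsSelection Q Z (U (p n)) (y n) (V n))
    (hV' : ∀ n, IsSelection Q Z (U (p' n)) (y' n) (V' n))
    (hb : ∀ n, ∫ ω, Z ω * V n ω ∂Q ≤ b) (hb' : ∀ n, b ≤ ∫ ω, Z ω * V' n ω ∂Q) :
    ∃ V₀, IsLagrangeSolution 𝒢 Q Z b (U p₀) y₀ V₀ := by
  have hpos : ∀ ω, 0 < y₀ * Z ω := fun ω => mul_pos hy₀ (hZ.pos ω)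
  have hm : Measurable[𝒢] fun ω => y₀ * Z ω := hZ.measurable.const_mul y₀
  -- Semicontinuity places `b` between the costs of the smallest and largest maximisers at `y₀`;
  -- mixing these two attains it. Both must be `𝒢`-measurable.
  obtain ⟨W, h1, h2, h3⟩ := hG.exists_selection_integral_eq hZ hp₀ hy₀
    (@IsUtilityFamily.measurable_minMaximizer_comp _ _ _ _ hU _ hp₀ _ 𝒢 _ hm hpos) 
    (@IsUtilityFamily.measurable_maxMaximizer_comp _ _ _ _ hU _ hp₀ _ 𝒢 _ hm hpos)
    (ae_of_all _ fun ω => hU.minMaximizer_mem hp₀ (hpos ω))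
    (ae_of_all _ fun ω => hU.maxMaximizer_mem hp₀ (hpos ω))
    (hU.integral_minMaximizer_le hZ hG hp hp₀ hpt hy hy₀ hyt hVm hV hb)
    (hU.le_integral_maxMaximizer hZ hG hp' hp₀ hpt' hy' hy₀ hyt' hVm' hV' hb')
  exact ⟨W, h1, h2, h3⟩

/-- The cost of the largest maximiser decreases in `y` and crosses `b`, possibly by a jump. The
multiplier is the supremum of those with cost at least `b`, approached from both sides. -/
lemma IsUtilityFamily.exists_lagrangeSolution (hU : IsUtilityFamily P U)
    (hZ : IsPricingKernel 𝒢 Q Z) (hG : IsDominated Q Z P U) (hb : 0 < b)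
    {p : X} (hp : p ∈ P) : ∃ y, 0 < y ∧ ∃ V, IsLagrangeSolution 𝒢 Q Z b (U p) y V := by
  set V : ℝ → Ω → ℝ := fun y ω => maxMaximizer (U p) (y * Z ω) with hVdef
  set h : ℝ → ℝ := fun y => ∫ ω, Z ω * V y ω ∂Q with hh
  have hpos : ∀ y, 0 < y → ∀ ω, 0 < y * Z ω := fun y hy ω => mul_pos hy (hZ.pos ω)
  have hVm : ∀ y, 0 < y → Measurable (V y) := fun y hy =>
    hU.measurable_maxMaximizer_comp hp (hZ.measurable'.const_mul y) (hpos y hy)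
  have hVs : ∀ y, 0 < y → IsSelection Q Z (U p) y (V y) := fun y hy =>
    ae_of_all _ fun ω => hU.maxMaximizer_mem hp (hpos y hy ω)
  have hanti : ∀ y y', 0 < y → y < y' → h y' ≤ h y := by
    intro y y' hy hyy'
    have hy' := hy.trans hyy'
    refine integral_mono (hG.integrable hZ hp hy' (hVm y' hy') (hVs y' hy')).2
      (hG.integrable hZ hp hy (hVm y hy) (hVs y hy)).2 fun ω => ?_
    exact mul_le_mul_of_nonneg_left (le_of_mem_maximizers
      (mul_lt_mul_of_pos_right hyy' (hZ.pos ω)) (hU.maxMaximizer_mem hp (hpos y hy ω))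
      (hU.maxMaximizer_mem hp (hpos y' hy' ω))) (hZ.pos ω).le
  have hsmall : ∃ y, 0 < y ∧ b ≤ h y := by
    by_contra! hcon
    have hpos1 : ∀ n : ℕ, (0 : ℝ) < 1 / ((n : ℝ) + 1) := fun n => Nat.one_div_pos_of_nat
    exact hU.not_tendsto_multiplier_zero hZ hG (fun _ => hp) hp tendsto_const_nhds
      (y := fun n : ℕ => 1 / ((n : ℝ) + 1)) hpos1 (fun n => hVm _ (hpos1 n))
      (fun n => hVs _ (hpos1 n)) (fun n => (hcon _ (hpos1 n)).le)
      tendsto_one_div_add_atTop_nhds_zero_nat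
  have hlarge : ∃ y, 0 < y ∧ h y < b := by
    have hpos1 : ∀ n : ℕ, (0 : ℝ) < (n : ℝ) + 1 := fun n => by positivity
    have hlim := hU.tendsto_integral_of_multiplier_tendsto_atTop hZ hG (fun _ => hp)
      (y := fun n : ℕ => (n : ℝ) + 1)
      (tendsto_atTop_add_const_right _ _ tendsto_natCast_atTop_atTop)
      (fun n => hVm _ (hpos1 n)) (fun n => hVs _ (hpos1 n))
    obtain ⟨n, hn⟩ := (hlim.eventually_lt_const hb).exists
    exact ⟨_, hpos1 n, hn⟩
  set S : Set ℝ := {y | 0 < y ∧ b ≤ h y} with hS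
  have hbdd : BddAbove S := by
    obtain ⟨y₁, hy₁, hlt⟩ := hlarge
    refine ⟨y₁, fun y hy => ?_⟩
    by_contra! hcon
    exact absurd (hy.2.trans (hanti y₁ y hy₁ hcon)) (not_le.2 hlt)
  obtain ⟨ys, hys⟩ := hsmall
  set y₀ := sSup S with hy₀def
  have hy₀ : 0 < y₀ := hys.1.trans_le (le_csSup hbdd hys)
  -- The offset `1 / (n + 2)` is below `1` already at `n = 0`, which keeps the lower multipliers
  -- positive.
  have hn0 : ∀ n : ℕ, (0 : ℝ) < 1 / ((n : ℝ) + 1 + 1) := fun n => by positivity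
  have hn1 : ∀ n : ℕ, 1 / ((n : ℝ) + 1 + 1) < 1 := fun n => by
    rw [div_lt_one (by positivity)]
    linarith [(Nat.cast_nonneg n : (0 : ℝ) ≤ n)]
  have hlim : Tendsto (fun n : ℕ => 1 / ((n : ℝ) + 1 + 1)) atTop (𝓝 0) := by
    simpa [Function.comp_def] using
      (tendsto_one_div_add_atTop_nhds_zero_nat (𝕜 := ℝ)).comp (tendsto_add_atTop_nat 1)
  have hlow : ∀ n : ℕ, 0 < y₀ * (1 - 1 / ((n : ℝ) + 1 + 1)) := fun n =>
    mul_pos hy₀ (by linarith [hn1 n])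
  have hup : ∀ n : ℕ, 0 < y₀ * (1 + 1 / ((n : ℝ) + 1 + 1)) := fun n =>
    mul_pos hy₀ (by linarith [hn0 n])
  refine ⟨y₀, hy₀, hU.exists_lagrangeSolution_of_tendsto hZ hG (fun _ => hp) (fun _ => hp) hp
    tendsto_const_nhds tendsto_const_nhds hup hlow hy₀ ?_ ?_ (fun n => hVm _ (hup n))
    (fun n => hVm _ (hlow n)) (fun n => hVs _ (hup n)) (fun n => hVs _ (hlow n))
    (fun n => ?_) (fun n => ?_)⟩
  · simpa using (hlim.const_add 1).const_mul y₀
  · simpa using (hlim.const_sub 1).const_mul y₀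
  · by_contra! hcon
    have := le_csSup hbdd (⟨hup n, hcon.le⟩ : y₀ * (1 + 1 / ((n : ℝ) + 1 + 1)) ∈ S)
    nlinarith [hn0 n]
  · have hlt : y₀ * (1 - 1 / ((n : ℝ) + 1 + 1)) < sSup S := by
      rw [← hy₀def]
      nlinarith [hn0 n]
    obtain ⟨y₁, hy₁, hlt'⟩ := exists_lt_of_lt_csSup ⟨ys, hys⟩ hlt
    exact hy₁.2.trans (hanti _ _ (hlow n) hlt')

/-- The multipliers of a convergent sequence of problems subconverge. -/
lemma IsUtilityFamily.exists_subseq_multiplier (hU : IsUtilityFamily P U)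
    (hZ : IsPricingKernel 𝒢 Q Z) (hG : IsDominated Q Z P U) (hb : 0 < b)
    {p : ℕ → X} {p₀ : X} (hp : ∀ n, p n ∈ P) (hp₀ : p₀ ∈ P) (hpt : Tendsto p atTop (𝓝 p₀))
    {y : ℕ → ℝ} (hy : ∀ n, 0 < y n) {V : ℕ → Ω → ℝ}
    (hV : ∀ n, IsLagrangeSolution 𝒢 Q Z b (U (p n)) (y n) (V n)) :
    ∃ φ : ℕ → ℕ, StrictMono φ ∧ ∃ y₀, 0 < y₀ ∧ Tendsto (y ∘ φ) atTop (𝓝 y₀) := by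
  -- Compactness of `[0, ∞]` supplies a limit. At `∞` the cost would tend to `0 ≠ b`; `0` is
  -- excluded by Fatou's lemma.
  obtain ⟨t, φ, hφ, ht⟩ := CompactSpace.tendsto_subseq fun n => ENNReal.ofReal (y n)
  refine ⟨φ, hφ, ?_⟩
  have hVm := fun n => (hV (φ n)).measurable.mono hZ.le le_rfl
  have htop : t ≠ ∞ := by
    rintro rfl
    have hy' : Tendsto (y ∘ φ) atTop atTop := by
      refine tendsto_atTop.2 fun c => ?_
      filter_upwards [ht.eventually_const_lt (ENNReal.ofReal_lt_top (r := c))] with n hn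
      exact (ENNReal.ofReal_lt_ofReal_iff'.1 hn).1.le
    have hlim := hU.tendsto_integral_of_multiplier_tendsto_atTop hZ hG (fun n => hp (φ n)) hy'
      hVm (fun n => (hV (φ n)).selection)
    simp only [(hV _).integral_eq] at hlim
    exact hb.ne (tendsto_nhds_unique hlim tendsto_const_nhds)
  have hlim : Tendsto (y ∘ φ) atTop (𝓝 t.toReal) := by
    refine ((ENNReal.tendsto_toReal htop).comp ht).congr fun n => ?_
    simp [ENNReal.toReal_ofReal (hy _).le]
  refine ⟨t.toReal, lt_of_le_of_ne ENNReal.toReal_nonneg fun h0 => ?_, hlim⟩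
  rw [← h0] at hlim
  exact hU.not_tendsto_multiplier_zero hZ hG (fun n => hp (φ n)) hp₀ (hpt.comp hφ.tendsto_atTop)
    (fun n => hy (φ n)) hVm (fun n => (hV (φ n)).selection)
    (fun n => (hV (φ n)).integral_eq.le) hlim

/-- Expectations at optimal terminal values depend continuously on the parameter. -/
lemma IsUtilityFamily.tendsto_integral_isOptimalTerminalValue (hU : IsUtilityFamily P U)
    (hZ : IsPricingKernel 𝒢 Q Z) (hG : IsDominated Q Z P U) (hb : 0 < b)
    {p : ℕ → X} {p₀ : X} (hp : ∀ n, p n ∈ P) (hp₀ : p₀ ∈ P) (hpt : Tendsto p atTop (𝓝 p₀))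
    {V : ℕ → Ω → ℝ} (hV : ∀ n, IsOptimalTerminalValue 𝒢 Q Z b (U (p n)) (V n))
    {V₀ : Ω → ℝ} (hV₀ : IsOptimalTerminalValue 𝒢 Q Z b (U p₀) V₀) {F : X → ℝ → ℝ}
    (hF : ContinuousOn (fun q : X × ℝ => F q.1 q.2) (P ×ˢ Ici 0)) {a : ℝ} (ha : 0 ≤ a)
    (hFa : ∀ p ∈ P, ∀ v, 0 ≤ v → |F p v| ≤ a * (1 + v)) :
    Tendsto (fun n => ∫ ω, F (p n) (V n ω) ∂Q) atTop (𝓝 (∫ ω, F p₀ (V₀ ω) ∂Q)) := by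
  have hex : ∀ n, ∃ y, 0 < y ∧ IsLagrangeSolution 𝒢 Q Z b (U (p n)) y (V n) := fun n => by
    obtain ⟨y, hy, W, hW⟩ := hU.exists_lagrangeSolution hZ hG hb (hp n)
    exact ⟨y, hy, hW.of_isOptimalTerminalValue hU hZ hG hb.le (hp n) hy (hV n)⟩
  choose y hy hL using hex
  refine tendsto_of_subseq_tendsto fun ns hns => ?_
  obtain ⟨φ, hφ, y₀, hy₀, hyt⟩ := hU.exists_subseq_multiplier hZ hG hb (fun n => hp (ns n)) hp₀
    (hpt.comp hns) (fun n => hy (ns n)) (fun n => hL (ns n))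
  have hpt' : Tendsto (fun n => p (ns (φ n))) atTop (𝓝 p₀) :=
    (hpt.comp hns).comp hφ.tendsto_atTop
  have hVm := fun n => (hL (ns (φ n))).measurable.mono hZ.le le_rfl
  have hp' := fun n => hp (ns (φ n))
  have hy' := fun n => hy (ns (φ n))
  have hs := fun n => (hL (ns (φ n))).selection
  obtain ⟨W, hW⟩ := hU.exists_lagrangeSolution_of_tendsto hZ hG hp' hp' hp₀ hpt' hpt' hy' hy' hy₀
    hyt hyt hVm hVm hs hs (fun n => (hL (ns (φ n))).integral_eq.le)
    (fun n => (hL (ns (φ n))).integral_eq.ge)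
  -- Whatever the limit multiplier of this subsequence, `V₀` is a Lagrange solution for it, so all
  -- subsequences share one limit.
  exact ⟨φ, hU.tendsto_integral_lagrangeSolution hZ hG hp' hp₀ hpt' hy' hy₀ hyt
    (fun n => hL (ns (φ n)))
    (hW.of_isOptimalTerminalValue hU hZ hG hb.le hp₀ hy₀ hV₀) hF ha hFa⟩

lemma IsUtilityFamily.integrable_comp_isOptimalTerminalValue (hU : IsUtilityFamily P U)
    (hZ : IsPricingKernel 𝒢 Q Z) (hG : IsDominated Q Z P U) (hb : 0 < b) {p : X} (hp : p ∈ P)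
    {V : Ω → ℝ} (hV : IsOptimalTerminalValue 𝒢 Q Z b (U p) V) {f : ℝ → ℝ}
    (hf : ContinuousOn f (Ici 0)) {a : ℝ} (hfa : ∀ v, 0 ≤ v → |f v| ≤ a * (1 + v)) :
    Integrable (fun ω => f (V ω)) Q := by
  obtain ⟨y, hy, W, hW⟩ := hU.exists_lagrangeSolution hZ hG hb hp
  have hL := hW.of_isOptimalTerminalValue hU hZ hG hb.le hp hy hV
  have hm := hL.measurable.mono hZ.le le_rfl
  exact integrable_comp_of_abs_le hf hfa hm (hL.selection.mono fun ω h => h.1)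
    (hG.integrable hZ hp hy hm hL.selection).1

end

/-! ### Sublinear growth of utility functions -/

section Utility

variable {D : Set ℝ} {U : ℝ → ℝ}

/-- Up to a point `w₀ ≥ 0` with `U' w₀ < ε` monotonicity suffices; beyond it `U` lies below its
tangent at `w₀`. -/
lemma IsUtility.sublinear (hU : IsUtility D U) (hD : D.Nonempty) {ε : ℝ} (hε : 0 < ε) :
    ∃ C, 0 ≤ C ∧ ∀ w ∈ D, ∀ x, 0 ≤ x → w ≤ x → U w ≤ C + ε * x := by
  obtain ⟨d, hd⟩ := hD
  obtain ⟨w₀, hder, hdw, hw0⟩ := ((hU.inada_top.eventually_lt_const hε).and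
    ((eventually_gt_atTop d).and (eventually_ge_atTop 0))).exists
  have hIoi : Ioi d ⊆ D := fun x hx => hU.isUpperSet (le_of_lt hx) hd
  have hint : w₀ ∈ interior D := interior_maximal hIoi isOpen_Ioi hdw
  have hdiff : DifferentiableAt ℝ U w₀ :=
    (hU.contDiffOn.differentiableOn one_ne_zero).differentiableAt
      (isOpen_interior.mem_nhds hint)
  refine ⟨|U w₀|, abs_nonneg _, fun w hw x hx hwx => ?_⟩
  have habs := le_abs_self (U w₀)
  rcases le_or_gt w w₀ with h | h
  · have := hU.strictMonoOn.monotoneOn hw (interior_subset hint) h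
    have : 0 ≤ ε * x := by positivity
    linarith
  · have hs := hU.strictConcaveOn.concaveOn.slope_le_deriv (interior_subset hint) hw h hdiff
    rw [slope_def_field, div_le_iff₀ (sub_pos.2 h)] at hs
    have h1 : deriv U w₀ * (w - w₀) ≤ ε * (w - w₀) :=
      mul_le_mul_of_nonneg_right hder.le (sub_nonneg.2 h.le)
    nlinarith

end Utility

/-! ### Shape of the payoffs -/

/-- The admissible ranges of management fee, performance fee and first-loss coverage. -/
def IsFee (p : Fee) : Prop :=
  p.1 ∈ Icc (0 : ℝ) 1 ∧ p.2.1 ∈ Ioc (0 : ℝ) 1 ∧ p.2.2 ∈ Icc (0 : ℝ) 1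

/-- The manager's payoff in a fund without a bound on the manager's loss. -/
def uncappedPayoff (v₀ : ℝ) (p : Fee) (v : ℝ) : ℝ :=
  min (v - v₀) (p.1 * v₀ + p.2.1 * (v - (1 + p.1) * v₀))

section Payoff

variable {v₀ : ℝ} {p q : Fee} {v : ℝ}

/-- Isolates the only source of nonconcavity, the floor; the remaining part is a minimum of two
increasing affine functions. -/
lemma managerPayoff_eq (hv₀ : 0 < v₀) (hp : IsFee p) (v : ℝ) :
    managerPayoff v₀ p v = max ((p.1 - p.2.2) * v₀) (uncappedPayoff v₀ p v) := by
  obtain ⟨m, α, c⟩ := p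
  obtain ⟨⟨hm0, hm1⟩, ⟨ha0, ha1⟩, hc0, hc1⟩ := hp
  simp only [managerPayoff, investorPayoff, uncappedPayoff] at *
  have hcv : 0 ≤ c * v₀ := by positivity
  split_ifs with h1 h2
  · rw [max_eq_left]
    · ring
    · exact (min_le_left _ _).trans (by linarith)
  · rw [min_eq_left (by nlinarith), max_eq_right (by linarith)]
  · rw [min_eq_right (by nlinarith), max_eq_right (by nlinarith)]
    ring

lemma le_managerPayoff (hv₀ : 0 < v₀) (hp : IsFee p) (v : ℝ) :
    (p.1 - p.2.2) * v₀ ≤ managerPayoff v₀ p v := by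
  rw [managerPayoff_eq hv₀ hp]
  exact le_max_left _ _

lemma managerPayoff_le (hv₀ : 0 < v₀) (hp : IsFee p) (hv : 0 ≤ v) :
    managerPayoff v₀ p v ≤ (p.1 - p.2.2) * v₀ + v := by
  rw [managerPayoff_eq hv₀ hp]
  refine max_le (by linarith) ((min_le_left _ _).trans ?_)
  nlinarith [hp.1.1, hp.2.2.2]

lemma investorPayoff_eq (v₀ : ℝ) (p : Fee) (v : ℝ) :
    investorPayoff v₀ p v = v - managerPayoff v₀ p v := by
  simp [managerPayoff]

lemma managerPayoff_zero (hv₀ : 0 < v₀) (hp : IsFee p) :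
    managerPayoff v₀ p 0 = (p.1 - p.2.2) * v₀ :=
  le_antisymm (by simpa using managerPayoff_le hv₀ hp le_rfl) (le_managerPayoff hv₀ hp 0)

lemma managerPayoff_of_ge (hv₀ : 0 < v₀) (hp : IsFee p) (hv : (1 + p.1) * v₀ ≤ v) :
    managerPayoff v₀ p v = p.1 * v₀ + p.2.1 * (v - (1 + p.1) * v₀) := by
  obtain ⟨⟨hm0, hm1⟩, ⟨ha0, ha1⟩, hc0, hc1⟩ := hp
  rw [managerPayoff_eq hv₀ ⟨⟨hm0, hm1⟩, ⟨ha0, ha1⟩, hc0, hc1⟩, uncappedPayoff,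
    min_eq_right (by nlinarith), max_eq_right]
  nlinarith [mul_nonneg hc0 hv₀.le, mul_nonneg ha0.le (sub_nonneg.2 hv)]

lemma uncappedPayoff_strictMono (hp : IsFee p) : StrictMono (uncappedPayoff v₀ p) := by
  intro a b hab
  have := mul_lt_mul_of_pos_left hab hp.2.1.1
  exact lt_min ((min_le_left _ _).trans_lt (by linarith))
    ((min_le_right _ _).trans_lt (by nlinarith))

lemma uncappedPayoff_midpoint (v₀ : ℝ) (p : Fee) (a b : ℝ) :
    (uncappedPayoff v₀ p a + uncappedPayoff v₀ p b) / 2 ≤ uncappedPayoff v₀ p ((a + b) / 2) := by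
  have ha1 : uncappedPayoff v₀ p a ≤ _ := min_le_left _ _
  have ha2 : uncappedPayoff v₀ p a ≤ _ := min_le_right _ _
  have hb1 : uncappedPayoff v₀ p b ≤ _ := min_le_left _ _
  have hb2 : uncappedPayoff v₀ p b ≤ _ := min_le_right _ _
  exact le_min (by linarith) (by linarith)

lemma continuous_managerPayoff_formula (v₀ : ℝ) : Continuous fun q : Fee × ℝ =>
    max ((q.1.1 - q.1.2.2) * v₀) (uncappedPayoff v₀ q.1 q.2) := by
  unfold uncappedPayoff
  fun_prop

lemma continuousOn_managerPayoff (hv₀ : 0 < v₀) {P : Set Fee} (hP : ∀ p ∈ P, IsFee p) :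
    ContinuousOn (fun q : Fee × ℝ => managerPayoff v₀ q.1 q.2) (P ×ˢ Ici 0) :=
  (continuous_managerPayoff_formula v₀).continuousOn.congr fun q hq =>
    managerPayoff_eq hv₀ (hP q.1 hq.1) q.2

end Payoff

/-! ### The manager's utilities and comparison between fee structures -/

section Manager

variable {v₀ : ℝ} {P : Set Fee} {D : Set ℝ} {U : ℝ → ℝ}

lemma exists_neg_le_of_isCompact (hPc : IsCompact P) {f : Fee → ℝ} (hf : ContinuousOn f P) :
    ∃ c, 0 ≤ c ∧ ∀ p ∈ P, -c ≤ f p := by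
  obtain ⟨c, hc⟩ := hPc.bddBelow_image hf
  refine ⟨|c|, abs_nonneg c, fun p hp => (neg_abs_le c).trans ?_⟩
  exact hc ⟨p, hp, rfl⟩

/-- A positive maximiser is not on the floor, since `0` yields the same payoff at no cost. So both
points lie on the concave part, where strict concavity makes their midpoint strictly better. -/
lemma eq_zero_of_lt_of_mem_maximizers (hU : IsUtility D U) (hv₀ : 0 < v₀) {p : Fee} (hp : IsFee p)
    (hD : (p.1 - p.2.2) * v₀ ∈ D) {s : ℝ} (hs : 0 < s) {a b : ℝ}
    (ha : a ∈ maximizers (managerUtility U v₀ p) s)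
    (hb : b ∈ maximizers (managerUtility U v₀ p) s) (hab : a < b) : a = 0 := by
  by_contra hne
  have ha0 : 0 < a := lt_of_le_of_ne ha.1 (Ne.symm hne)
  have hmem : ∀ v, managerPayoff v₀ p v ∈ D := fun v =>
    hU.isUpperSet (le_managerPayoff hv₀ hp v) hD
  have hNa : (p.1 - p.2.2) * v₀ < uncappedPayoff v₀ p a := by
    by_contra! hle
    have h1 := ha.2 0 le_rfl
    have h2 : managerPayoff v₀ p a = managerPayoff v₀ p 0 := by
      rw [managerPayoff_zero hv₀ hp, managerPayoff_eq hv₀ hp, max_eq_left hle]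
    simp only [managerUtility, h2] at h1
    nlinarith
  have hNab := uncappedPayoff_strictMono (v₀ := v₀) hp hab
  have hMa : managerPayoff v₀ p a = uncappedPayoff v₀ p a := by
    rw [managerPayoff_eq hv₀ hp, max_eq_right hNa.le]
  have hMb : managerPayoff v₀ p b = uncappedPayoff v₀ p b := by
    rw [managerPayoff_eq hv₀ hp, max_eq_right (hNa.trans hNab).le]
  have hMc : uncappedPayoff v₀ p ((a + b) / 2) ≤ managerPayoff v₀ p ((a + b) / 2) := by
    rw [managerPayoff_eq hv₀ hp]
    exact le_max_right _ _
  have hmid := uncappedPayoff_midpoint v₀ p a b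
  have hDa : uncappedPayoff v₀ p a ∈ D := hMa ▸ hmem a
  have hDb : uncappedPayoff v₀ p b ∈ D := hMb ▸ hmem b
  have hconc := hU.strictConcaveOn.2 hDa hDb hNab.ne (one_half_pos (α := ℝ)) one_half_pos
    (add_halves 1)
  simp only [smul_eq_mul] at hconc
  have hDmid : 1 / 2 * uncappedPayoff v₀ p a + 1 / 2 * uncappedPayoff v₀ p b ∈ D :=
    hU.isUpperSet (by linarith) hDa
  have hmono := hU.strictMonoOn.monotoneOn hDmid (hmem ((a + b) / 2)) (by linarith)
  have h1 := ha.2 ((a + b) / 2) (by linarith)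
  have h2 := hb.2 ((a + b) / 2) (by linarith)
  simp only [managerUtility, hMa, hMb] at h1 h2
  linarith

lemma isUtilityFamily_managerUtility (hU : IsUtility D U) (hv₀ : 0 < v₀) (hPc : IsCompact P)
    (hPne : P.Nonempty) (hP : ∀ p ∈ P, IsFee p) (hD : ∀ p ∈ P, (p.1 - p.2.2) * v₀ ∈ D) :
    IsUtilityFamily P (managerUtility U v₀) := by
  have hmem : ∀ p ∈ P, ∀ v, managerPayoff v₀ p v ∈ D := fun p hp v =>
    hU.isUpperSet (le_managerPayoff hv₀ (hP p hp) v) (hD p hp)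
  obtain ⟨p₀, hp₀⟩ := hPne
  refine ⟨?_, fun ε hε => ?_, ?_, fun p hp v hv => ?_, fun p hp s hs a ha b hb hab => ?_⟩
  · exact hU.continuousOn.comp (continuousOn_managerPayoff hv₀ hP) fun q hq => hmem q.1 hq.1 q.2
  · obtain ⟨C, hC0, hC⟩ := hU.sublinear ⟨_, hD p₀ hp₀⟩ hε
    refine ⟨C + ε * v₀, by positivity, fun p hp v hv => ?_⟩
    have h1 := managerPayoff_le hv₀ (hP p hp) hv
    have h2 := hC _ (hmem p hp v) (v₀ + v) (by positivity)
      (h1.trans (by nlinarith [(hP p hp).1.2, (hP p hp).2.2.1]))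
    simp only [managerUtility]
    linarith
  · obtain ⟨c, hc0, hc⟩ := exists_neg_le_of_isCompact hPc
      (f := fun p => U ((p.1 - p.2.2) * v₀)) (hU.continuousOn.comp (by fun_prop) hD)
    exact ⟨c, hc0, fun p hp v _ => (hc p hp).trans
      (hU.strictMonoOn.monotoneOn (hD p hp) (hmem p hp v) (le_managerPayoff hv₀ (hP p hp) v))⟩
  -- From `2 * v₀ ≥ (1 + m) * v₀` on, the payoff is above the floor and strictly increasing.
  · refine ⟨max v (2 * v₀) + 1, by positivity,
      hU.strictMonoOn (hmem p hp _) (hmem p hp _) ?_⟩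
    obtain ⟨⟨hm0, hm1⟩, ⟨ha0, ha1⟩, hc0, hc1⟩ := hP p hp
    have hmono := (uncappedPayoff_strictMono (v₀ := v₀) (hP p hp))
    rw [managerPayoff_eq hv₀ (hP p hp), managerPayoff_eq hv₀ (hP p hp)]
    refine lt_max_of_lt_right (lt_of_le_of_lt ?_ (hmono (lt_add_one (max v (2 * v₀)))))
    refine max_le (le_trans ?_ (hmono.monotone (le_max_right _ _)))
      (hmono.monotone (le_max_left _ _))
    have hcv := mul_nonneg hc0 hv₀.le
    have hmv := mul_nonneg (sub_nonneg.2 hm1) hv₀.le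
    have hamv := mul_nonneg ha0.le hmv
    exact le_min (by linarith) (by linarith)
  · exact eq_zero_of_lt_of_mem_maximizers hU hv₀ (hP p hp) (hD p hp) hs ha hb hab

/-- The maximisers for one fee structure control those for all others. -/
lemma le_of_mem_maximizers_managerUtility (hU : IsUtility D U) (hv₀ : 0 < v₀) {p q : Fee}
    (hp : IsFee p) (hq : IsFee q) (hDq : (q.1 - q.2.2) * v₀ ∈ D)
    {s t : ℝ} (hs : 0 < s) (ht : 0 < t) (hts : t ≤ q.2.1 / 2 * s) {x x₀ : ℝ}
    (hx : x ∈ maximizers (managerUtility U v₀ p) s)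
    (hx₀ : x₀ ∈ maximizers (managerUtility U v₀ q) t) : x ≤ (6 * v₀ + x₀) / p.2.1 := by
  obtain ⟨m, α, c⟩ := p
  obtain ⟨n, β, d⟩ := q
  have hp' := hp
  have hq' := hq
  obtain ⟨⟨hm0, hm1⟩, ⟨ha0, ha1⟩, hc0, hc1⟩ := hp'
  obtain ⟨⟨hn0, hn1⟩, ⟨hb0, hb1⟩, hd0, hd1⟩ := hq'
  simp only at *
  have hx₀0 := hx₀.1
  rw [le_div_iff₀ ha0]
  have h1m : (1 + m) * v₀ ≤ 2 * v₀ := mul_le_mul_of_nonneg_right (by linarith) hv₀.le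
  have h1m0 : 0 ≤ (1 + m) * v₀ := by positivity
  have h1n0 : 0 ≤ (1 + n) * v₀ := by positivity
  rcases lt_or_ge x ((1 + m) * v₀) with hlt | hge
  · have := mul_le_of_le_one_right hx.1 ha1
    linarith
  set w := managerPayoff v₀ (m, α, c) x with hw
  have hwx : w = m * v₀ + α * (x - (1 + m) * v₀) := managerPayoff_of_ge hv₀ hp hge
  set w₀ := managerPayoff v₀ (n, β, d) x₀ with hw₀
  have hw₀le : w₀ ≤ v₀ + x₀ := (managerPayoff_le hv₀ hq hx₀0).trans (by simp only; nlinarith)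
  -- Payoffs are compared instead of fund values. If `w` exceeded both bounds, the manager under `q`
  -- would gain by moving from payoff `w₀` up to `w`.
  suffices h : w ≤ 4 * v₀ ∨ w ≤ w₀ by
    have h1 : w ≤ 4 * v₀ + x₀ := by rcases h with h | h <;> linarith
    have h2 : α * ((1 + m) * v₀) ≤ (1 + m) * v₀ := mul_le_of_le_one_left h1m0 ha1
    have h3 : 0 ≤ m * v₀ := by positivity
    linarith
  by_contra! hcon
  obtain ⟨h4, h0⟩ := hcon
  -- Lowering the payoff from `w` to `w'` lowers the fund value by `(w - w') / α ≥ w - w'`, so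
  -- optimality of `x` forces a utility loss of at least `s` per unit.
  have hslope : ∀ w', m * v₀ ≤ w' → w' ≤ w → s * (w - w') ≤ U w - U w' := by
    intro w' hw' hw'w
    have hx'ge : (1 + m) * v₀ ≤ (w' - m * v₀) / α + (1 + m) * v₀ := by
      have : 0 ≤ (w' - m * v₀) / α := div_nonneg (sub_nonneg.2 hw') ha0.le
      linarith
    have h1 := hx.2 ((w' - m * v₀) / α + (1 + m) * v₀) (h1m0.trans hx'ge)
    have h2 : managerPayoff v₀ (m, α, c) ((w' - m * v₀) / α + (1 + m) * v₀) = w' := by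
      rw [managerPayoff_of_ge hv₀ hp hx'ge]
      simp only
      field_simp
      ring
    simp only [managerUtility, h2, ← hw] at h1
    have h3 : x - ((w' - m * v₀) / α + (1 + m) * v₀) = (w - w') / α := by
      rw [hwx]
      field_simp
      ring
    have h5 : w - w' ≤ (w - w') / α := le_div_self (sub_nonneg.2 hw'w) ha0 ha1
    nlinarith
  -- The fund value at which `q` pays `w`. On the profit branch a unit of payoff costs `t / β ≤ s /
  -- 2`, half of what it is worth.
  set x₁ := (w - n * v₀) / β + (1 + n) * v₀ with hx₁
  have hx₁ge : (1 + n) * v₀ ≤ x₁ := by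
    have : 0 ≤ (w - n * v₀) / β := div_nonneg (by nlinarith) hb0.le
    linarith
  have hMx₁ : managerPayoff v₀ (n, β, d) x₁ = w := by
    rw [managerPayoff_of_ge hv₀ hq hx₁ge]
    simp only [hx₁]
    field_simp
    ring
  have hopt := hx₀.2 x₁ (h1n0.trans hx₁ge)
  simp only [managerUtility, hMx₁, ← hw₀] at hopt
  have hβx₁ : β * x₁ = w - n * v₀ + β * ((1 + n) * v₀) := by
    rw [hx₁]
    field_simp
  have hmv : m * v₀ ≤ v₀ := mul_le_of_le_one_left hv₀.le hm1
  have hnd : (n - d) * v₀ ≤ v₀ := mul_le_of_le_one_left hv₀.le (by linarith)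
  -- If `w₀ ≤ v₀`, the gain is at least `s * (w - v₀)` and the cost at most `s / 2 * (w + 2 * v₀)`;
  -- the gain is larger exactly for `w > 4 * v₀`. Otherwise `w₀` is bounded by the profit branch and
  -- increments compare directly.
  rcases le_or_gt w₀ v₀ with hle | hgt
  · have h1 := hslope v₀ hmv (by linarith)
    have h2 : U w₀ ≤ U v₀ := hU.strictMonoOn.monotoneOn
      (hU.isUpperSet (le_managerPayoff hv₀ hq x₀) hDq)
      (hU.isUpperSet hnd hDq) hle
    have h3 : t * (x₁ - x₀) ≤ t * x₁ := by nlinarith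
    have h5 : t * x₁ ≤ β / 2 * s * x₁ :=
      mul_le_mul_of_nonneg_right hts (h1n0.trans hx₁ge)
    have h6 : β / 2 * s * x₁ = s / 2 * (β * x₁) := by ring
    have h7 : β * x₁ ≤ w + 2 * v₀ := by
      rw [hβx₁]
      have := mul_le_of_le_one_left h1n0 hb1
      linarith
    have h8 : s / 2 * (β * x₁) ≤ s / 2 * (w + 2 * v₀) :=
      mul_le_mul_of_nonneg_left h7 (by positivity)
    have h9 : 0 < s * (w - 4 * v₀) := mul_pos hs (sub_pos.2 h4)
    linarith
  · have h1 := hslope w₀ (by linarith) h0.le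
    have h2 : w₀ ≤ n * v₀ + β * (x₀ - (1 + n) * v₀) := by
      by_contra! hlt
      have h3 := managerPayoff_eq hv₀ hq x₀
      rw [← hw₀] at h3
      have h5 : uncappedPayoff v₀ (n, β, d) x₀ < w₀ := (min_le_right _ _).trans_lt hlt
      have h6 : (n - d) * v₀ < w₀ := hnd.trans_lt hgt
      exact (max_lt h6 h5).ne h3.symm
    have h3 : β * (x₁ - x₀) ≤ w - w₀ := by linarith
    have h5 : s / 2 * (β * (x₁ - x₀)) ≤ s / 2 * (w - w₀) :=
      mul_le_mul_of_nonneg_left h3 (by positivity)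
    have h6 : 0 < s * (w - w₀) := mul_pos hs (sub_pos.2 h0)
    rcases le_or_gt x₁ x₀ with h7 | h7
    · have h8 : 0 ≤ t * (x₀ - x₁) := mul_nonneg ht.le (sub_nonneg.2 h7)
      linarith
    · have h8 : t * (x₁ - x₀) ≤ β / 2 * s * (x₁ - x₀) :=
        mul_le_mul_of_nonneg_right hts (sub_nonneg.2 h7.le)
      linarith

end Manager

/-! ### Gaussian shift and the state price density -/

section Gaussian

/-- The Cameron–Martin formula in dimension one: translate Lebesgue measure and complete the square.
-/
lemma lintegral_gaussianReal_shift {v : ℝ≥0} (hv : v ≠ 0) (γ : ℝ) {f : ℝ → ℝ≥0∞}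
    (hf : Measurable f) :
    ∫⁻ w, f w ∂(gaussianReal 0 v)
      = ∫⁻ w, ENNReal.ofReal (Real.exp (-γ * w - γ ^ 2 * v / 2)) * f (w + γ * v)
          ∂(gaussianReal 0 v) := by
  have hv' : (v : ℝ) ≠ 0 := by exact_mod_cast hv
  rw [gaussianReal_of_var_ne_zero _ hv,
    lintegral_withDensity_eq_lintegral_mul _ (measurable_gaussianPDF 0 v) hf,
    lintegral_withDensity_eq_lintegral_mul _ (measurable_gaussianPDF 0 v) (by fun_prop),
    ← lintegral_add_right_eq_self _ (γ * v)]
  refine lintegral_congr fun w => ?_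
  simp only [Pi.mul_apply, gaussianPDF, gaussianPDFReal]
  rw [← mul_assoc, ← ENNReal.ofReal_mul (by positivity), mul_assoc _ (Real.exp _) (Real.exp _),
    ← Real.exp_add]
  congr 4
  field_simp
  ring

variable {Ω : Type*} {mΩ : MeasurableSpace Ω} {Q : Measure Ω} {ℱ : Filtration ℝ≥0 mΩ}
  {T : ℝ≥0} {W : ℝ≥0 → Ω → ℝ}

lemma IsWienerProcess.measurable_terminal (hW : IsWienerProcess Q ℱ T W) :
    Measurable[ℱ T] (W T) :=
  hW.adapted T le_rfl

lemma IsWienerProcess.map_terminal (hW : IsWienerProcess Q ℱ T W) :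
    Q.map (W T) = gaussianReal 0 T := by
  have h := hW.gaussian_increments 0 T zero_le le_rfl
  rw [tsub_zero] at h
  rw [← h]
  refine Measure.map_congr ?_
  filter_upwards [hW.zero] with ω hω
  simp [hω]

lemma IsWienerProcess.measure_terminal_eq (hT : 0 < T) (hW : IsWienerProcess Q ℱ T W) (a : ℝ) :
    Q {ω | W T ω = a} = 0 := by
  have := nullSingletonClass_gaussianReal (μ := 0) hT.ne'
  have h : Q.map (W T) {a} = 0 := by
    rw [hW.map_terminal]
    exact measure_singleton a
  rwa [Measure.map_apply (hW.measurable_terminal.mono (ℱ.le T) le_rfl)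
    (measurableSet_singleton a)] at h

/-- The density of the shift by `γ T` is `Z` up to a constant, and the shift multiplies `Z` by `exp
(-γ² T)`. This trades unweighted expectations for ones weighted by `Z`. -/
lemma lintegral_statePriceDensity_shift (hT : 0 < T) (hW : IsWienerProcess Q ℱ T W)
    (r μ σ : ℝ) {f : ℝ → ℝ≥0∞} (hf : Measurable f) :
    ∃ C : ℝ≥0∞, C ≠ ∞ ∧ ∃ k > 0, ∫⁻ ω, f (statePriceDensity r μ σ W T ω) ∂Q
      = C * ∫⁻ ω, ENNReal.ofReal (statePriceDensity r μ σ W T ω)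
          * f (k * statePriceDensity r μ σ W T ω) ∂Q := by
  set γ := marketPriceOfRisk r μ σ with hγ
  set A : ℝ := -(r + (1 / 2) * γ ^ 2) * (T : ℝ) with hA
  have hm : Measurable (W T) := hW.measurable_terminal.mono (ℱ.le T) le_rfl
  refine ⟨ENNReal.ofReal (Real.exp (-A - γ ^ 2 * T / 2)), ENNReal.ofReal_ne_top,
    Real.exp (-γ ^ 2 * T), Real.exp_pos _, ?_⟩
  have h1 : ∀ ω, statePriceDensity r μ σ W T ω = Real.exp (A - γ * W T ω) := fun ω => rfl
  simp only [h1]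
  have hg : Measurable fun w : ℝ => f (Real.exp (A - γ * w)) := hf.comp (by fun_prop)
  have hg' : Measurable fun w : ℝ => ENNReal.ofReal (Real.exp (A - γ * w))
      * f (Real.exp (-γ ^ 2 * T) * Real.exp (A - γ * w)) :=
    Measurable.mul (by fun_prop) (hf.comp (by fun_prop))
  rw [← lintegral_map (μ := Q) (g := W T) hg hm, ← lintegral_map (μ := Q) (g := W T) hg' hm,
    hW.map_terminal, lintegral_gaussianReal_shift hT.ne' γ hg, ← lintegral_const_mul _ hg']
  refine lintegral_congr fun w => ?_
  rw [← mul_assoc, ← ENNReal.ofReal_mul (Real.exp_pos _).le, ← Real.exp_add, ← Real.exp_add]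
  congr 3
  · ring
  · ring

lemma measurable_statePriceDensity (hW : IsWienerProcess Q ℱ T W) (r μ σ : ℝ) :
    Measurable[ℱ T] (statePriceDensity r μ σ W T) :=
  Real.measurable_exp.comp ((hW.measurable_terminal.const_mul _).const_sub _)

lemma isPricingKernel_statePriceDensity [IsProbabilityMeasure Q] (hT : 0 < T)
    (hW : IsWienerProcess Q ℱ T W) (r μ σ : ℝ) :
    IsPricingKernel (ℱ T) Q (statePriceDensity r μ σ W T) := by
  have hm := measurable_statePriceDensity hW r μ σ
  have hm' := hm.mono (ℱ.le T) le_rfl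
  have hpos : ∀ ω, 0 < statePriceDensity r μ σ W T ω := fun ω => Real.exp_pos _
  refine ⟨ℱ.le T, hm, hpos, ?_, ?_, W T, hW.measurable_terminal, hW.measure_terminal_eq hT⟩
  -- For `f = 1` the identity reads `1 = C * E[Z]`, which rules out `E[Z] = ∞`.
  · obtain ⟨C, hC, k, hk, h⟩ := lintegral_statePriceDensity_shift hT hW r μ σ
      (f := fun _ => 1) measurable_const
    simp only [lintegral_const, measure_univ, mul_one] at h
    refine (lintegral_ofReal_ne_top_iff_integrable hm'.aestronglyMeasurable
      (ae_of_all _ fun ω => (hpos ω).le)).1 fun htop => ?_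
    rw [htop, ENNReal.mul_top'] at h
    split_ifs at h
    · exact one_ne_zero h
    · exact ENNReal.one_ne_top h
  · by_cases hγ : marketPriceOfRisk r μ σ = 0
    · left
      refine ⟨Real.exp (-r * T), fun ω => ?_⟩
      simp [statePriceDensity, hγ]
    · right
      intro z
      refine measure_mono_null (fun ω hω => ?_) (hW.measure_terminal_eq hT
        ((-(r + (1 / 2) * marketPriceOfRisk r μ σ ^ 2) * (T : ℝ) - Real.log z)
          / marketPriceOfRisk r μ σ))
      simp only [mem_ofPred_eq, statePriceDensity] at hω ⊢
      rw [← hω, Real.log_exp]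
      field_simp
      ring

end Gaussian

/-! ### An integrable bound uniform in the fees -/

section Domination

variable {Ω : Type*} {mΩ : MeasurableSpace Ω} {Q : Measure Ω}
  {ℱ : Filtration ℝ≥0 mΩ} {T : ℝ≥0} {W : ℝ≥0 → Ω → ℝ} {v₀ : ℝ} {P : Set Fee} {D : Set ℝ}
  {U : ℝ → ℝ}

/-- The hypothesis concerns maximisers for the envelope. Those at multiplier `y / 2` dominate all
maximisers for `U p` at `y`; halving makes the slope strictly smaller. -/
lemma lintegral_mul_maxMaximizer_lt_top {X : Type*} [TopologicalSpace X] {P : Set X}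
    {U : X → ℝ → ℝ} (hU : IsUtilityFamily P U) {p : X} (hp : p ∈ P) {Z : Ω → ℝ}
    (hpos : ∀ ω, 0 < Z ω) (hint : IntegrabilityCondition Q Z (U p)) {y : ℝ} (hy : 0 < y) :
    ∫⁻ ω, ENNReal.ofReal (Z ω * maxMaximizer (U p) (y * Z ω)) ∂Q < ∞ := by
  obtain ⟨v, hv, hfin⟩ := hint
  refine (lintegral_mono fun ω => ENNReal.ofReal_le_ofReal ?_).trans_lt (hfin (y / 2) (by linarith))
  obtain ⟨h0, hmax⟩ := hv (y / 2) (by linarith) (Z ω) (hpos ω)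
  refine mul_le_mul_of_nonneg_left ?_ (hpos ω).le
  refine le_of_isMaxOn_concaveEnvelope (s := y * Z ω) ?_
    (hU.maxMaximizer_mem hp (mul_pos hy (hpos ω))) h0 hmax
  have := mul_pos hy (hpos ω)
  linarith

/-- The bound comes from the largest maximiser `g` of one fee structure `q`, divided by the least
performance fee in `P`, which is positive by compactness. The shift reduces integrability of `g` to
that of `Z g` at another multiplier. -/
lemma isDominated_managerUtility [IsProbabilityMeasure Q] (hT : 0 < T) (hW : IsWienerProcess Q ℱ T W) (r μ σ : ℝ)
    (hU : IsUtility D U) (hv₀ : 0 < v₀) (hPc : IsCompact P)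
    (hPne : P.Nonempty) (hP : ∀ p ∈ P, IsFee p) (hD : ∀ p ∈ P, (p.1 - p.2.2) * v₀ ∈ D)
    (hint : ∀ p ∈ P,
      IntegrabilityCondition Q (statePriceDensity r μ σ W T) (managerUtility U v₀ p)) :
    IsDominated Q (statePriceDensity r μ σ W T) P (managerUtility U v₀) := by
  have hF := isUtilityFamily_managerUtility hU hv₀ hPc hPne hP hD
  have hZ := isPricingKernel_statePriceDensity hT hW r μ σ
  set Z := statePriceDensity r μ σ W T with hZdef
  obtain ⟨q, hq⟩ := hPne
  obtain ⟨pa, hpa, hpamin⟩ := hPc.exists_isMinOn ⟨q, hq⟩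
    (f := fun p : Fee => p.2.1) (by fun_prop)
  have ha0 := (hP pa hpa).2.1.1
  have hb0 := (hP q hq).2.1.1
  intro y hy
  have hc : 0 < q.2.1 / 2 * y := by positivity
  set c := q.2.1 / 2 * y with hcdef
  have hpos : ∀ k : ℝ, 0 < k → ∀ ω, 0 < k * Z ω := fun k hk ω => mul_pos hk (hZ.pos ω)
  set g : Ω → ℝ := fun ω => maxMaximizer (managerUtility U v₀ q) (c * Z ω) with hg
  have hgmem : ∀ ω, g ω ∈ maximizers (managerUtility U v₀ q) (c * Z ω) := fun ω =>
    hF.maxMaximizer_mem hq (hpos c hc ω)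
  have hgm : Measurable g :=
    hF.measurable_maxMaximizer_comp hq (hZ.measurable'.const_mul c) (hpos c hc)
  have hfin : ∀ k, 0 < k → ∫⁻ ω, ENNReal.ofReal
      (Z ω * maxMaximizer (managerUtility U v₀ q) (k * Z ω)) ∂Q < ∞ := fun k hk =>
    lintegral_mul_maxMaximizer_lt_top hF hq hZ.pos (hint q hq) hk
  have hZg : Integrable (fun ω => Z ω * g ω) Q :=
    (lintegral_ofReal_ne_top_iff_integrable (hZ.measurable'.mul hgm).aestronglyMeasurable
      (ae_of_all _ fun ω => mul_nonneg (hZ.pos ω).le (hgmem ω).1)).1 (hfin c hc).ne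
  have hgi : Integrable g Q := by
    refine (lintegral_ofReal_ne_top_iff_integrable hgm.aestronglyMeasurable
      (ae_of_all _ fun ω => (hgmem ω).1)).1 ?_
    -- `exp (log z)` equals `z` for `z > 0` and is positive everywhere, which gives measurability on
    -- the whole line.
    have hfm : Measurable fun z : ℝ => ENNReal.ofReal
        (maxMaximizer (managerUtility U v₀ q) (c * Real.exp (Real.log z))) :=
      (hF.measurable_maxMaximizer_comp hq (f := fun z : ℝ => c * Real.exp (Real.log z))
        (by fun_prop) fun z => by positivity).ennreal_ofReal
    obtain ⟨C, hC, k, hk, h⟩ := lintegral_statePriceDensity_shift hT hW r μ σ hfm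
    have h1 : ∀ ω, Real.exp (Real.log (Z ω)) = Z ω := fun ω => Real.exp_log (hZ.pos ω)
    have h2 : ∀ ω, Real.exp (Real.log (k * Z ω)) = k * Z ω := fun ω =>
      Real.exp_log (hpos k hk ω)
    simp only [← hZdef, h1, h2, ← mul_assoc, ← ENNReal.ofReal_mul (hZ.pos _).le] at h
    rw [h]
    exact ENNReal.mul_ne_top hC (hfin (c * k) (by positivity)).ne
  refine ⟨fun ω => (6 * v₀ + g ω) / pa.2.1, ((integrable_const _).add hgi).div_const _, ?_,
    fun ω => ?_, fun p hp y' hy' ω x hx => ?_⟩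
  · have : (fun ω => Z ω * ((6 * v₀ + g ω) / pa.2.1))
        = fun ω => (6 * v₀ * Z ω + Z ω * g ω) / pa.2.1 := by
      ext ω
      ring
    rw [this]
    exact ((hZ.integrable.const_mul _).add hZg).div_const _
  · have := (hgmem ω).1
    positivity
  · have hgω := (hgmem ω).1
    have hαle : pa.2.1 ≤ p.2.1 := hpamin hp
    refine (le_of_mem_maximizers_managerUtility hU hv₀ (hP p hp) (hP q hq) (hD q hq)
      (hpos y' (by linarith) ω) (hpos c hc ω) ?_ hx (hgmem ω)).trans ?_
    · rw [hcdef, mul_assoc]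
      exact mul_le_mul_of_nonneg_left (mul_le_mul_of_nonneg_right hy' (hZ.pos ω).le) (by positivity)
    · exact div_le_div_of_nonneg_left (by positivity) ha0 hαle

end Domination

/-! ### Continuity and linear growth of the investor's utility -/

section Investor

variable {v₀ : ℝ} {P : Set Fee} {D : Set ℝ} {U : ℝ → ℝ}

lemma le_investorPayoff (hv₀ : 0 < v₀) {p : Fee} (hp : IsFee p) {v : ℝ} (hv : 0 ≤ v) :
    (p.2.2 - p.1) * v₀ ≤ investorPayoff v₀ p v := by
  have := managerPayoff_le hv₀ hp hv
  rw [investorPayoff_eq]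
  linarith

lemma continuousOn_investorUtility (hU : IsUtility D U) (hv₀ : 0 < v₀) (hP : ∀ p ∈ P, IsFee p)
    (hD : ∀ p ∈ P, (p.2.2 - p.1) * v₀ ∈ D) :
    ContinuousOn (fun q : Fee × ℝ => investorUtility U v₀ q.1 q.2) (P ×ˢ Ici 0) := by
  have h : ContinuousOn (fun q : Fee × ℝ => investorPayoff v₀ q.1 q.2) (P ×ˢ Ici 0) := by
    simp only [investorPayoff_eq]
    exact continuousOn_snd.sub (continuousOn_managerPayoff hv₀ hP)
  exact hU.continuousOn.comp h fun q hq =>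
    hU.isUpperSet (le_investorPayoff hv₀ (hP q.1 hq.1) hq.2) (hD q.1 hq.1)

lemma exists_abs_investorUtility_le (hU : IsUtility D U) (hv₀ : 0 < v₀) (hPc : IsCompact P)
    (hPne : P.Nonempty) (hP : ∀ p ∈ P, IsFee p) (hD : ∀ p ∈ P, (p.2.2 - p.1) * v₀ ∈ D) :
    ∃ a, 0 ≤ a ∧ ∀ p ∈ P, ∀ v, 0 ≤ v → |investorUtility U v₀ p v| ≤ a * (1 + v) := by
  obtain ⟨p₀, hp₀⟩ := hPne
  obtain ⟨C, hC0, hC⟩ := hU.sublinear ⟨_, hD p₀ hp₀⟩ one_pos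
  obtain ⟨c, hc0, hc⟩ := exists_neg_le_of_isCompact hPc
    (f := fun p => U ((p.2.2 - p.1) * v₀)) (hU.continuousOn.comp (by fun_prop) hD)
  refine ⟨C + c + v₀ + 1, by positivity, fun p hp v hv => ?_⟩
  have hle := le_investorPayoff hv₀ (hP p hp) hv
  have hmem := hU.isUpperSet hle (hD p hp)
  have hlow := (hc p hp).trans (hU.strictMonoOn.monotoneOn (hD p hp) hmem hle)
  have hub : investorPayoff v₀ p v ≤ v₀ + v := by
    have h1 := le_managerPayoff hv₀ (hP p hp) v
    rw [investorPayoff_eq]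
    nlinarith [(hP p hp).1.1, (hP p hp).2.2.2]
  have hup := hC _ hmem (v₀ + v) (by positivity) hub
  have hCv : 0 ≤ (C + c + v₀) * v := by positivity
  simp only [investorUtility]
  exact abs_le.2 ⟨by linarith, by linarith⟩

end Investor

end FirstLoss

/-! ### The proposition -/

open FirstLoss
theorem mainTheorem6 {Ω : Type*} {mΩ : MeasurableSpace Ω} (Q : Measure Ω) [IsProbabilityMeasure Q]
    (ℱ : Filtration ℝ≥0 mΩ) (T : ℝ≥0) (hT : 0 < T)
    (W : ℝ≥0 → Ω → ℝ) (hW : IsWienerProcess Q ℱ T W)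
    (r μ σ : ℝ) (hσ : 0 < σ) (v₀ : ℝ) (hv₀ : 0 < v₀)
    (P : Set Fee) (hPcompact : IsCompact P) (hPne : P.Nonempty)
    (hP : ∀ p ∈ P, p.1 ∈ Icc (0 : ℝ) 1 ∧ p.2.1 ∈ Ioc (0 : ℝ) 1 ∧ p.2.2 ∈ Icc (0 : ℝ) 1)
    (DM DI : Set ℝ) (UM UI : ℝ → ℝ) (hUM : IsUtility DM UM) (hUI : IsUtility DI UI)
    (hDM : ∀ p ∈ P, (p.1 - p.2.2) * v₀ ∈ DM) (hDI : ∀ p ∈ P, (p.2.2 - p.1) * v₀ ∈ DI)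
    (hint : ∀ p ∈ P,
      IntegrabilityCondition Q (statePriceDensity r μ σ W T) (managerUtility UM v₀ p)) :
    -- the manager's problem is solvable for every admissible fee structure
    (∀ p ∈ P, ∃ V : Ω → ℝ, IsOptimalTerminalValue (ℱ T) Q (statePriceDensity r μ σ W T) v₀
      (managerUtility UM v₀ p) V) ∧
    -- the expected utilities at an optimal terminal value are finite
    (∀ p ∈ P, ∀ V : Ω → ℝ, IsOptimalTerminalValue (ℱ T) Q (statePriceDensity r μ σ W T) v₀
        (managerUtility UM v₀ p) V →
      Integrable (fun ω => managerUtility UM v₀ p (V ω)) Q ∧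
      Integrable (fun ω => investorUtility UI v₀ p (V ω)) Q) ∧
    -- and they do not depend on the choice of the optimal terminal value
    (∀ p ∈ P, ∀ V V' : Ω → ℝ,
      IsOptimalTerminalValue (ℱ T) Q (statePriceDensity r μ σ W T) v₀
        (managerUtility UM v₀ p) V →
      IsOptimalTerminalValue (ℱ T) Q (statePriceDensity r μ σ W T) v₀
        (managerUtility UM v₀ p) V' →
      ∫ ω, managerUtility UM v₀ p (V ω) ∂Q = ∫ ω, managerUtility UM v₀ p (V' ω) ∂Q ∧
      ∫ ω, investorUtility UI v₀ p (V ω) ∂Q = ∫ ω, investorUtility UI v₀ p (V' ω) ∂Q) ∧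
    -- the Pareto problem for the resulting value functions
    ∀ V : Fee → Ω → ℝ,
      (∀ p ∈ P, IsOptimalTerminalValue (ℱ T) Q (statePriceDensity r μ σ W T) v₀
        (managerUtility UM v₀ p) (V p)) →
      ∃ pmin ∈ P, ∃ pmax ∈ P,
        IsMinOn (valueFunction Q (managerUtility UM v₀) V) P pmin ∧
        IsMaxOn (valueFunction Q (managerUtility UM v₀) V) P pmax ∧
        ∀ φmin ∈ Icc (valueFunction Q (managerUtility UM v₀) V pmin)
            (valueFunction Q (managerUtility UM v₀) V pmax),
          ∃ pstar : Fee, SolvesParetoProblem P (valueFunction Q (managerUtility UM v₀) V)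
            (valueFunction Q (investorUtility UI v₀) V) φmin pstar := by

  have hZ := isPricingKernel_statePriceDensity hT hW r μ σ
  have hF := isUtilityFamily_managerUtility hUM hv₀ hPcompact hPne hP hDM
  have hG := isDominated_managerUtility hT hW r μ σ hUM hv₀ hPcompact hPne hP hDM hint
  have hIc := continuousOn_investorUtility hUI hv₀ hP hDI
  obtain ⟨aM, haM0, haM⟩ := hF.exists_abs_le
  obtain ⟨aI, haI0, haI⟩ := exists_abs_investorUtility_le hUI hv₀ hPcompact hPne hP hDI
  have hIcp : ∀ p ∈ P, ContinuousOn (investorUtility UI v₀ p) (Ici 0) := fun p hp =>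
    hIc.comp (f := fun v : ℝ => (p, v)) (by fun_prop) fun _ hv => ⟨hp, hv⟩
  refine ⟨fun p hp => ?_, fun p hp V hV => ⟨?_, ?_⟩, fun p hp V V' hV hV' => ⟨?_, ?_⟩,
    fun V hV => ?_⟩
  · obtain ⟨y, hy, V, hV⟩ := hF.exists_lagrangeSolution hZ hG hv₀ hp
    exact ⟨V, hV.isOptimalTerminalValue hF hZ hG hv₀.le hp hy⟩
  · exact hF.integrable_comp_isOptimalTerminalValue hZ hG hv₀ hp hV (hF.continuousOn_apply hp)
      (haM p hp)
  · exact hF.integrable_comp_isOptimalTerminalValue hZ hG hv₀ hp hV (hIcp p hp) (haI p hp)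
  -- Stability along the constant sequence `V` with limit problem solved by `V'` gives independence
  -- of the choice.
  · exact tendsto_nhds_unique tendsto_const_nhds
      (hF.tendsto_integral_isOptimalTerminalValue hZ hG hv₀ (fun _ => hp) hp tendsto_const_nhds
        (fun _ => hV) hV' hF.continuousOn haM0 haM)
  · exact tendsto_nhds_unique tendsto_const_nhds
      (hF.tendsto_integral_isOptimalTerminalValue hZ hG hv₀ (fun _ => hp) hp tendsto_const_nhds
        (fun _ => hV) hV' hIc haI0 haI)
  · have hcont : ∀ {F : Fee → ℝ → ℝ} {a : ℝ},
        ContinuousOn (fun q : Fee × ℝ => F q.1 q.2) (P ×ˢ Ici 0) → 0 ≤ a →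
        (∀ p ∈ P, ∀ v, 0 ≤ v → |F p v| ≤ a * (1 + v)) → ContinuousOn (valueFunction Q F V) P := by
      intro F a hFc ha hFa
      rw [continuousOn_iff_continuous_domRestrict, continuous_iff_seqContinuous]
      intro p p₀ hp
      exact hF.tendsto_integral_isOptimalTerminalValue hZ hG hv₀ (fun n => (p n).2) p₀.2
        (continuous_subtype_val.continuousAt.tendsto.comp hp) (fun n => hV _ (p n).2)
        (hV _ p₀.2) hFc ha hFa
    have hM := hcont hF.continuousOn haM0 haM
    have hI := hcont hIc haI0 haI
    obtain ⟨pmin, hpmin, hmin⟩ := hPcompact.exists_isMinOn hPne hM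
    obtain ⟨pmax, hpmax, hmax⟩ := hPcompact.exists_isMaxOn hPne hM
    refine ⟨pmin, hpmin, pmax, hpmax, hmin, hmax, fun φmin hφ => ?_⟩
    -- The feasible fee structures form a compact set, which contains `pmax` since `φmin` does not
    -- exceed the maximum.
    have hK : IsCompact (P ∩ valueFunction Q (managerUtility UM v₀) V ⁻¹' Ici φmin) :=
      hPcompact.of_isClosed_subset
        (hM.preimage_isClosed_of_isClosed hPcompact.isClosed isClosed_Ici) inter_subset_left
    obtain ⟨p, hp, hpopt⟩ := hK.exists_isMaxOn ⟨pmax, hpmax, hφ.2⟩ (hI.mono inter_subset_left)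
    exact ⟨p, hp.1, hp.2, fun q hq hqφ => hpopt ⟨hq, hqφ⟩⟩
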